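/- **Model.** Let $G=(V,E)$ be a graph with $n$ vertices (resources), and let $m$ users be assigned to the vertices; $x_v$ is the number of users on $v$ (its load). User $i$ has a threshold $T_v^i$ for each vertex $v$; the thresholds are above average if $T_v^i>\overline T:=\lceil m/n\rceil$ for all $i,v$. A state is balanced if $x_v\le T_v^i$ for every user $i$ and the vertex $v$ it is assigned to. In a round of the resource-controlled protocol every vertex $v$ ranks its users in non-increasing order of $T_v^i$ (ties broken by the index); if $r$ is the last position in this ranking held by a user $i$ with $r\le T_v^i$ ($r=0$ if there is none), then all users ranked after position $r$ leave, each of them moving, concurrently and independently, to a uniformly random neighbour of $v$. Let $\mathbf P$ be the transition matrix of the simple random walk on $G$, let $\mu = 1-\max\{|\lambda| : \lambda \text{ an eigenvalue of } \mathbf P,\ |\lambda|<1\}$, and let $\mathsf{MIX}(G)=4\ln n/\mu$. **Graphs.** For even $n$ and $1\le k\le n^2/5$ let $\mathcal G_{n,k}$ be the class of graphs on $n$ vertices that consist of two disjoint cliques $V_1,V_2$ of size $n/2$ and $k$ edges between them, such that every vertex has at least $\lfloor k/(n/2)\rfloor$ and at most $\lceil k/(n/2)\rceil$ neighbours in the other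 clique. **Theorem.** Every class $\mathcal G_{n,k}$ is non-empty, and the following holds. 1. There are constants $c,C>0$ such that for all even $n$, all integers $1\le k\le n^2/5$ and all $G\in\mathcal G_{n,k}$ we have $\mu>0$ and $$c\cdot\frac{n^2}{k}\ln n\;\le\;\mathsf{MIX}(G)\;\le\; C\cdot\frac{n^2}{k}\ln n ,$$ and for all $0<\varepsilon\le \frac12$ and $m\ge Cn$ the thresholds $T_v^i=T:=\lceil(1+\varepsilon)\overline T\rceil$ are above average and there is an initial state of the following form from which the protocol needs in expectation at least $$c\cdot\frac{\mathsf{MIX}(G)}{\ln n}\cdot\ln m\qquad\text{and at least}\qquad c\cdot\frac{n^2}{k}\cdot\ln m$$ rounds to reach a balanced state: all users are on $V_1$, one vertex $v\in V_1$ with exactly $\lfloor k/(n/2)\rfloor$ neighbours in $V_2$ carries at least $T$ users, and every other vertex of $V_1$ carries exactly $T$ users. 2. For every $\kappa>0$ there are constants $c,C>0$ such that for all even $n$, all integers $k$ with $\max\{1,\kappa n\ln n\}\le k\le n^2/5$, all $G\in\mathcal G_{n,k}$ and all $m\ge Cn^2$ the thresholds $T_v^i=\overline T+1$ are above average and there is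 an initial state from which the protocol needs in expectation at least $c\cdot\mathsf{MIX}(G)\cdot\ln m$ rounds to reach a balanced state. -/

import Mathlib

open MeasureTheory ProbabilityTheory
open scoped ENNReal

noncomputable section

/-! ### Random walks and the mixing time -/

open Classical in
/-- Transition matrix of the simple random walk on `G`: `P u v = 1 / deg u` if `u` and `v` are
adjacent, and `P u v = 0` otherwise. -/
def walkMatrix {V : Type*} [Fintype V] (G : SimpleGraph V) : Matrix V V ℝ :=
  fun u v => if G.Adj u v then 1 / (G.degree u : ℝ) else 0

/-- `μ = 1 - max {|lam| : lam an eigenvalue of P, |lam| < 1}`. All eigenvalues of `P` are real, and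
the largest one is `1`, so that it makes no difference whether one copy of it is left out. -/
def walkGap {V : Type*} [Fintype V] (G : SimpleGraph V) : ℝ :=
  1 - sSup {r : ℝ | ∃ lam : ℝ,
    Module.End.HasEigenvalue (walkMatrix G).mulVecLin lam ∧ |lam| < 1 ∧ r = |lam|}

/-- The mixing time `MIX(G) = 4 log n / μ`. -/
def mixingTime {V : Type*} [Fintype V] (G : SimpleGraph V) : ℝ :=
  4 * Real.log (Fintype.card V) / walkGap G

/-! ### Users, thresholds, balanced states -/

open Classical in
/-- The load `x_v` of the resource `v` in the state `a`. -/
def load {V : Type*} {m : ℕ} (a : Fin m → V) (v : V) : ℕ :=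
  (Finset.univ.filter fun i => a i = v).card

/-- The average `⌈m / n⌉` for `m` users on `n` resources. -/
def averageLoad (m n : ℕ) : ℕ := ⌈(m : ℝ) / (n : ℝ)⌉₊

/-- The thresholds `T i v` (user `i`, resource `v`) are above average. -/
def AboveAverage {V : Type*} [Fintype V] {m : ℕ} (T : Fin m → V → ℝ) : Prop :=
  ∀ i v, (averageLoad m (Fintype.card V) : ℝ) < T i v

/-- Every user is happy with its resource. -/
def BalancedState {V : Type*} {m : ℕ} (T : Fin m → V → ℝ) (a : Fin m → V) : Prop :=
  ∀ i, (load a (a i) : ℝ) ≤ T i (a i)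

/-! ### The resource-controlled protocol -/

open Classical in
/-- Position (starting from `1`) of user `i` among the users on its resource `a i`, in
non-increasing order of their thresholds for that resource; ties are broken by the index. -/
def userRank {V : Type*} {m : ℕ} (T : Fin m → V → ℝ) (a : Fin m → V) (i : Fin m) : ℕ :=
  (Finset.univ.filter fun j => a j = a i ∧
    (T i (a i) < T j (a i) ∨ (T j (a i) = T i (a i) ∧ j ≤ i))).card

open Classical in
/-- The last position in the ranking on `v` held by a user whose threshold for `v` is at least
this position (`0` if there is none). -/
def keptUsers {V : Type*} {m : ℕ} (T : Fin m → V → ℝ) (a : Fin m → V) (v : V) : ℕ :=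
  (Finset.univ.filter fun i => a i = v ∧ (userRank T a i : ℝ) ≤ T i v).sup (userRank T a)

/-- User `i` is assigned to leave its resource. -/
def Leaves {V : Type*} {m : ℕ} (T : Fin m → V → ℝ) (a : Fin m → V) (i : Fin m) : Prop :=
  keptUsers T a (a i) < userRank T a i

open Classical in
/-- Law of a uniformly random neighbour of `v` (an isolated vertex is never left). -/
def neighborLaw {V : Type*} [MeasurableSpace V] (G : SimpleGraph V) (v : V) : Measure V :=
  if (G.neighborSet v).Nonempty then uniformOn (G.neighborSet v) else Measure.dirac v

instance {V : Type*} [Finite V] [MeasurableSpace V] [MeasurableSingletonClass V]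
    (G : SimpleGraph V) (v : V) : IsProbabilityMeasure (neighborLaw G v) := by
  unfold neighborLaw
  split_ifs with h
  · exact isProbabilityMeasure_uniformOn (Set.toFinite _) h
  · infer_instance

open Classical in
/-- Law of the position of user `i` after one round from the state `a`. -/
def moveLaw {V : Type*} [MeasurableSpace V] {m : ℕ} (G : SimpleGraph V)
    (T : Fin m → V → ℝ) (a : Fin m → V) (i : Fin m) : Measure V :=
  if Leaves T a i then neighborLaw G (a i) else Measure.dirac (a i)

instance {V : Type*} [Finite V] [MeasurableSpace V] [MeasurableSingletonClass V] {m : ℕ}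
    (G : SimpleGraph V) (T : Fin m → V → ℝ) (a : Fin m → V) (i : Fin m) :
    IsProbabilityMeasure (moveLaw G T a i) := by
  unfold moveLaw
  split_ifs <;> infer_instance

/-- One round of the protocol, as a Markov kernel on states: the users move concurrently and
independently. -/
def roundKernel {V : Type*} [Finite V] [MeasurableSpace V] [MeasurableSingletonClass V] {m : ℕ}
    (G : SimpleGraph V) (T : Fin m → V → ℝ) : Kernel (Fin m → V) (Fin m → V) :=
  Kernel.ofFunOfCountable fun a => Measure.pi (moveLaw G T a)

instance {V : Type*} [Finite V] [MeasurableSpace V] [MeasurableSingletonClass V] {m : ℕ}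
    (G : SimpleGraph V) (T : Fin m → V → ℝ) : IsMarkovKernel (roundKernel G T) :=
  ⟨fun a => inferInstanceAs (IsProbabilityMeasure (Measure.pi (moveLaw G T a)))⟩

/-- The round kernel as a kernel from histories up to time `t` to the state at time `t + 1`. -/
def historyKernel {V : Type*} [Finite V] [MeasurableSpace V] [MeasurableSingletonClass V] {m : ℕ}
    (G : SimpleGraph V) (T : Fin m → V → ℝ) (t : ℕ) :
    Kernel ((_ : Finset.Iic t) → (Fin m → V)) (Fin m → V) :=
  (roundKernel G T).comap (fun h => h ⟨t, Finset.mem_Iic.2 le_rfl⟩) (measurable_pi_apply _)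

instance {V : Type*} [Finite V] [MeasurableSpace V] [MeasurableSingletonClass V] {m : ℕ}
    (G : SimpleGraph V) (T : Fin m → V → ℝ) (t : ℕ) : IsMarkovKernel (historyKernel G T t) :=
  inferInstanceAs (IsMarkovKernel (Kernel.comap _ _ _))

/-- Law of the sequence of states visited by the protocol when it starts in the state `a`. -/
def protocolLaw {V : Type*} [Finite V] [MeasurableSpace V] [MeasurableSingletonClass V] {m : ℕ}
    (G : SimpleGraph V) (T : Fin m → V → ℝ) (a : Fin m → V) : Measure (ℕ → (Fin m → V)) :=
  Kernel.trajMeasure (X := fun _ => Fin m → V) (Measure.dirac a) (historyKernel G T)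

/-- Number of rounds until the sequence of states `ω` is balanced (`∞` if this never happens). -/
def balancingTime {V : Type*} {m : ℕ} (T : Fin m → V → ℝ) (ω : ℕ → (Fin m → V)) : ℝ≥0∞ :=
  ⨅ t ∈ {t : ℕ | BalancedState T (ω t)}, (t : ℝ≥0∞)

/-- Expected number of rounds until the protocol, started in the state `a`, is balanced. -/
def expectedRounds {V : Type*} [Finite V] [MeasurableSpace V] [MeasurableSingletonClass V]
    {m : ℕ} (G : SimpleGraph V) (T : Fin m → V → ℝ) (a : Fin m → V) : ℝ≥0∞ :=
  ∫⁻ ω, balancingTime T ω ∂(protocolLaw G T a)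

/-! ### Two cliques with a sparse, evenly spread cut -/

open Classical in
/-- Number of neighbours of `v` in `W`. -/
def degreeInto {V : Type*} (G : SimpleGraph V) (W : Finset V) (v : V) : ℕ :=
  (W.filter fun w => G.Adj v w).card

/-- `G` consists of two cliques `V₁`, `V₂` of equal size `N` and `k` edges between them, and every
vertex has at least `⌊k / N⌋` and at most `⌈k / N⌉` neighbours in the other clique. -/
structure IsJoinedCliques {V : Type*} [Fintype V] (G : SimpleGraph V) (V₁ V₂ : Finset V)
    (k : ℕ) : Prop where
  disjoint : Disjoint V₁ V₂
  cover : ∀ v, v ∈ V₁ ∨ v ∈ V₂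
  card_eq : V₁.card = V₂.card
  clique₁ : G.IsClique V₁
  clique₂ : G.IsClique V₂
  cut : ∑ v ∈ V₁, degreeInto G V₂ v = k
  even₁ : ∀ v ∈ V₁, k / V₁.card ≤ degreeInto G V₂ v ∧ degreeInto G V₂ v ≤ k ⌈/⌉ V₁.card
  even₂ : ∀ v ∈ V₂, k / V₂.card ≤ degreeInto G V₁ v ∧ degreeInto G V₁ v ≤ k ⌈/⌉ V₂.card

end

/-! Both lower bounds come from one mechanism. With a common threshold `T`, ties are broken by
index, so if the users of smallest index fill a set `F` with exactly `T` users per resource, they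
never move (`IsSeeded.not_leaves`), and every other user must leave as long as it stands on `F`
(`IsSeeded.leaves`). Until it first exits `F`, such an extra user performs a random walk, and
balance requires all extra users to be off `F`. If `ψ` is supported in `F` and `P ψ ≥ ρ ψ` on `F`,
then by independence within a round the probability of balance after `t` rounds is at most the
product of `1 - ρ ^ t * ψ (a i)` over the extra users (`IsSeeded.prob_balanced_le`). With
polynomially many extra users and `ρ = exp (-x)`, order `log m / x` rounds are needed
(`IsSeeded.le_expectedRounds`). For the first bound `F` is the clique `V₁`, and `ψ` is the
probability to stay in it for one step; the exit rate `x` is of order `k / n ^ 2`. For the second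
bound `F` omits a single vertex, which the walk hits at rate of order `1 / n`, so that `n * log m`
rounds are needed; for `k ≥ κ n log n` this dominates `MIX(G) * log m`. The mixing time is governed
by a gap of order `k / n ^ 2`. The function `±1` on the two cliques bounds the gap from above
through its Rayleigh quotient (`walkGap_le`). From below, a Poincaré inequality routes all pairs of
vertices through the cut (`poincare`), and the edges inside the cliques keep eigenvalues away from
`-1` (`neg_le_eigenvalue`). Non-emptiness of the class is shown by a circulant cut. -/

theorem not_leaves_of_balanced {V : Type*} {m : ℕ} {T : Fin m → V → ℝ}
    {b : Fin m → V} (hb : BalancedState T b)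
    (i : Fin m) : ¬ Leaves T b i := by
  classical
  unfold Leaves keptUsers
  rw [not_lt]
  -- A rank is at most the load, hence at most the user's own threshold, so every user is among
  -- those that define `keptUsers`.
  apply Finset.le_sup (f := userRank T b)
  simp only [Finset.mem_filter, Finset.mem_univ, true_and]
  refine le_trans ?_ (hb i)
  unfold userRank load
  norm_cast
  apply Finset.card_le_card
  intro j hj
  simp only [Finset.mem_filter, Finset.mem_univ, true_and] at hj ⊢
  exact hj.1

/-! ### The protocol as a Markov chain -/

section ProtocolChain

variable {V : Type*} [Fintype V] [MeasurableSpace V] [MeasurableSingletonClass V] {m : ℕ}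
  (G : SimpleGraph V) (T : Fin m → V → ℝ) (a : Fin m → V)

instance : IsProbabilityMeasure (protocolLaw G T a) :=
  inferInstanceAs (IsProbabilityMeasure (Kernel.trajMeasure _ _))

theorem protocolLaw_ae_zero : ∀ᵐ ω ∂protocolLaw G T a, ω 0 = a := by
  have h0 : (protocolLaw G T a).map (fun ω => ω 0) = Measure.dirac a := by
    have h : (protocolLaw G T a).map (Preorder.frestrictLe (π := fun _ => Fin m → V) 0) =
        (Measure.dirac a).map
          (MeasurableEquiv.piUnique (fun _ : Finset.Iic 0 => (Fin m → V))).symm := by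
      unfold protocolLaw Kernel.trajMeasure
      rw [Measure.map_comp _ _ (by fun_prop), Kernel.traj_map_frestrictLe,
        Kernel.partialTraj_self, Measure.id_comp]
    have h2 : (fun ω : ℕ → (Fin m → V) => ω 0) =
        (MeasurableEquiv.piUnique (fun _ : Finset.Iic 0 => (Fin m → V))) ∘
          (Preorder.frestrictLe (π := fun _ => Fin m → V) 0) := by
      funext ω
      rfl
    rw [h2, ← Measure.map_map (MeasurableEquiv.measurable _) (by fun_prop), h,
      MeasurableEquiv.map_map_symm]
  have h1 : ∀ᵐ b ∂((protocolLaw G T a).map (fun ω => ω 0)), b = a := by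
    rw [h0, ae_dirac_eq]
    exact rfl
  exact ae_of_ae_map (measurable_pi_apply 0).aemeasurable h1

/-- The Markov property: history and next state are jointly distributed as a composition product
with `historyKernel`, which reads only the last state. -/
theorem lintegral_protocolLaw_step (t : ℕ) (g : (Fin m → V) → (Fin m → V) → ℝ≥0∞) :
    ∫⁻ ω, g (ω t) (ω (t + 1)) ∂protocolLaw G T a =
      ∫⁻ ω, ∫⁻ b, g (ω t) b ∂roundKernel G T (ω t) ∂protocolLaw G T a := by
  have key := Kernel.map_frestrictLe_trajMeasure_compProd_eq_map_trajMeasure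
    (X := fun _ => Fin m → V) (μ₀ := Measure.dirac a) (κ := historyKernel G T) (a := t)
  let t' : Finset.Iic t := ⟨t, Finset.mem_Iic.2 le_rfl⟩
  let F : ((_ : Finset.Iic t) → (Fin m → V)) × (Fin m → V) → ℝ≥0∞ := fun p => g (p.1 t') p.2
  have hF : Measurable F := by
    have : Measurable fun p : (Fin m → V) × (Fin m → V) => g p.1 p.2 := Measurable.of_discrete
    have h : Measurable fun p : ((_ : Finset.Iic t) → (Fin m → V)) × (Fin m → V) =>
        (p.1 t', p.2) := ((measurable_pi_apply t').comp measurable_fst).prodMk measurable_snd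
    exact this.comp h
  have h1 : ∫⁻ ω, g (ω t) (ω (t + 1)) ∂protocolLaw G T a =
      ∫⁻ p, F p ∂((protocolLaw G T a).map
        (fun x => (Preorder.frestrictLe (π := fun _ => Fin m → V) t x, x (t + 1)))) := by
    rw [lintegral_map hF (by fun_prop)]
    rfl
  rw [h1]
  unfold protocolLaw
  rw [← key, Measure.lintegral_compProd hF, lintegral_map]
  · rfl
  · exact hF.lintegral_kernel_prod_right'
  · fun_prop

theorem protocolLaw_ae_step (t : ℕ) (R : (Fin m → V) → (Fin m → V) → Prop)
    (hR : ∀ b, ∀ᵐ b' ∂roundKernel G T b, R b b') :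
    ∀ᵐ ω ∂protocolLaw G T a, R (ω t) (ω (t + 1)) := by
  classical
  have h := lintegral_protocolLaw_step G T a t (fun b b' => if R b b' then 0 else 1)
  have h0 : ∀ b, ∫⁻ b', (if R b b' then 0 else 1 : ℝ≥0∞) ∂roundKernel G T b = 0 := by
    intro b
    rw [lintegral_eq_zero_iff Measurable.of_discrete]
    filter_upwards [hR b] with b' hb'
    simp [hb']
  simp only [h0, lintegral_zero] at h
  rw [lintegral_eq_zero_iff] at h
  · filter_upwards [h] with ω hω
    by_contra hc
    simp [hc] at hω
  · have : Measurable fun p : (Fin m → V) × (Fin m → V) =>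
        (if R p.1 p.2 then 0 else 1 : ℝ≥0∞) := Measurable.of_discrete
    have h' : Measurable fun ω : ℕ → (Fin m → V) => (ω t, ω (t + 1)) :=
      (measurable_pi_apply t).prodMk (measurable_pi_apply (t + 1))
    exact this.comp h'

theorem roundKernel_apply (b : Fin m → V) :
    roundKernel G T b = Measure.pi (moveLaw G T b) := rfl

theorem roundKernel_ae_stay (b : Fin m → V) :
    ∀ᵐ b' ∂roundKernel G T b, ∀ i, ¬ Leaves T b i → b' i = b i := by
  rw [ae_all_iff]
  intro i
  by_cases hi : Leaves T b i
  · simp [hi]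
  simp only [hi, not_false_eq_true, forall_const]
  rw [roundKernel_apply]
  have h1 : ∀ᵐ x ∂moveLaw G T b i, x = b i := by
    unfold moveLaw
    rw [if_neg hi, ae_dirac_eq]
    exact rfl
  exact (Measure.quasiMeasurePreserving_eval (μ := moveLaw G T b) i).ae h1

/-- Almost surely, users that are not assigned to leave stay where they are. -/
theorem protocolLaw_ae_stay :
    ∀ᵐ ω ∂protocolLaw G T a, ∀ t i, ¬ Leaves T (ω t) i → ω (t + 1) i = ω t i := by
  rw [ae_all_iff]
  intro t
  exact protocolLaw_ae_step G T a t (fun b b' => ∀ i, ¬ Leaves T b i → b' i = b i)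
    (roundKernel_ae_stay G T)

/-- A family of functions that dominates one round on an almost surely invariant set of states
bounds the expected value at time `t`. -/
theorem lintegral_protocolLaw_le (S : Set (Fin m → V))
    (hS : ∀ᵐ ω ∂protocolLaw G T a, ∀ t, ω t ∈ S)
    (u : ℕ → (Fin m → V) → ℝ≥0∞)
    (hu : ∀ t, ∀ b ∈ S, ∫⁻ b', u t b' ∂roundKernel G T b ≤ u (t + 1) b) (t : ℕ) :
    ∫⁻ ω, u 0 (ω t) ∂protocolLaw G T a ≤ u t a := by
  -- The index `r` stays free in the induction on `s`: undoing the last round lowers the time by one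
  -- and raises the index by one.
  have key : ∀ s r, ∫⁻ ω, u r (ω s) ∂protocolLaw G T a ≤ u (r + s) a := by
    intro s
    induction s with
    | zero =>
      intro r
      have : ∀ᵐ ω ∂protocolLaw G T a, u r (ω 0) = u r a := by
        filter_upwards [protocolLaw_ae_zero G T a] with ω hω
        rw [hω]
      rw [lintegral_congr_ae this]
      simp
    | succ s ih =>
      intro r
      calc ∫⁻ ω, u r (ω (s + 1)) ∂protocolLaw G T a
          = ∫⁻ ω, ∫⁻ b, u r b ∂roundKernel G T (ω s) ∂protocolLaw G T a :=
            lintegral_protocolLaw_step G T a s (fun _ b => u r b)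
        _ ≤ ∫⁻ ω, u (r + 1) (ω s) ∂protocolLaw G T a := by
            apply lintegral_mono_ae
            filter_upwards [hS] with ω hω
            exact hu r _ (hω s)
        _ ≤ u (r + 1 + s) a := ih _
        _ = u (r + (s + 1)) a := by rw [add_assoc, add_comm 1 s]
  simpa using key t 0

/-- Nobody leaves a balanced state, so such states are absorbing; being unbalanced at time `t` then
means that the balancing time exceeds `t`. -/
theorem protocolLaw_ae_balanced_mono :
    ∀ᵐ ω ∂protocolLaw G T a, ∀ s t, s ≤ t → BalancedState T (ω s) → BalancedState T (ω t) := by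
  filter_upwards [protocolLaw_ae_stay G T a] with ω hω s t hst hs
  induction t, hst using Nat.le_induction with
  | base => exact hs
  | succ t _ ih =>
    have : ω (t + 1) = ω t := funext fun i => hω t i (not_leaves_of_balanced ih i)
    rwa [this]

/-- If the state at time `t` is balanced with probability at most `1/2`, then the expected number
of rounds is at least `(t + 1) / 2`. -/
theorem le_expectedRounds (t : ℕ)
    (ht : protocolLaw G T a {ω | BalancedState T (ω t)} ≤ 1 / 2) :
    ((t + 1 : ℕ) : ℝ≥0∞) / 2 ≤ expectedRounds G T a := by
  classical
  have hmeas : MeasurableSet {ω : ℕ → (Fin m → V) | BalancedState T (ω t)} := by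
    have h : Measurable fun ω : ℕ → (Fin m → V) => ω t := measurable_pi_apply t
    exact h (MeasurableSet.of_discrete (s := {b | BalancedState T b}))
  have h1 : (1 / 2 : ℝ≥0∞) ≤ protocolLaw G T a {ω | BalancedState T (ω t)}ᶜ := by
    rw [prob_compl_eq_one_sub hmeas]
    calc (1 / 2 : ℝ≥0∞) = 1 - 1 / 2 := by simp
      _ ≤ _ := tsub_le_tsub_left ht 1
  calc ((t + 1 : ℕ) : ℝ≥0∞) / 2 = ((t + 1 : ℕ) : ℝ≥0∞) * (1 / 2) := by
        rw [mul_one_div]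
    _ ≤ ((t + 1 : ℕ) : ℝ≥0∞) * protocolLaw G T a {ω | BalancedState T (ω t)}ᶜ := by gcongr
    _ = ∫⁻ ω, {ω | BalancedState T (ω t)}ᶜ.indicator (fun _ => ((t + 1 : ℕ) : ℝ≥0∞)) ω
          ∂protocolLaw G T a := by
        rw [lintegral_indicator_const hmeas.compl]
    _ ≤ expectedRounds G T a := by
        apply lintegral_mono_ae
        filter_upwards [protocolLaw_ae_balanced_mono G T a] with ω hω
        by_cases hb : BalancedState T (ω t)
        · simp [hb]
        · rw [Set.indicator_of_mem (by exact hb)]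
          unfold balancingTime
          refine le_iInf₂ fun s hs => ?_
          have : t + 1 ≤ s := by
            by_contra hc
            exact hb (hω s t (by omega) hs)
          exact_mod_cast this

end ProtocolChain

/-! ### States in which the first users fill a set exactly -/

section SeededStates

variable {V : Type*} {m : ℕ}

/-- The users of index less than `b` all sit on `F`, with exactly `T` of them on each resource
of `F`. -/
structure IsSeeded (F : Finset V) (T b : ℕ) (a : Fin m → V) : Prop where
  mem : ∀ i : Fin m, i.val < b → a i ∈ F
  card : ∀ u ∈ F, {i : Fin m | i.val < b ∧ a i = u}.ncard = T

open Classical in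
-- With a common threshold every comparison is a tie, which the index decides.
theorem userRank_const (T : ℝ) (a : Fin m → V) (i : Fin m) :
    userRank (fun _ _ => T) a i = (Finset.univ.filter fun j => a j = a i ∧ j ≤ i).card := by
  unfold userRank
  congr 1
  ext j
  simp

open Classical in
theorem IsSeeded.card_filter {F : Finset V} {T b : ℕ} {a : Fin m → V} (h : IsSeeded F T b a)
    {u : V} (hu : u ∈ F) :
    (Finset.univ.filter fun i : Fin m => i.val < b ∧ a i = u).card = T := by
  rw [← h.card u hu, Set.ncard_eq_toFinset_card']
  congr 1
  ext
  simp

/-- Only seeds can be ranked ahead of a seed, and its resource holds exactly `T` of them, itself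
included. So its rank is at most `T`, wherever the other users are. -/
theorem IsSeeded.not_leaves {F : Finset V} {T b : ℕ} {a : Fin m → V} (h : IsSeeded F T b a)
    {i : Fin m} (hi : i.val < b) : ¬ Leaves (fun _ _ => (T : ℝ)) a i := by
  classical
  unfold Leaves keptUsers
  rw [not_lt]
  apply Finset.le_sup (f := userRank _ a)
  simp only [Finset.mem_filter, Finset.mem_univ, true_and, Nat.cast_le]
  rw [userRank_const, ← h.card_filter (h.mem i hi)]
  apply Finset.card_le_card
  intro j hj
  simp only [Finset.mem_filter, Finset.mem_univ, true_and] at hj ⊢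
  exact ⟨lt_of_le_of_lt hj.2 hi, hj.1⟩

/-- All `T` seeds of the resource have smaller index, and the user itself is counted as well. -/
theorem IsSeeded.lt_userRank {F : Finset V} {T b : ℕ} {a : Fin m → V} (h : IsSeeded F T b a)
    {i : Fin m} (hi : b ≤ i.val) (hF : a i ∈ F) : T < userRank (fun _ _ => (T : ℝ)) a i := by
  classical
  rw [userRank_const]
  nth_rewrite 1 [← h.card_filter hF]
  apply Finset.card_lt_card
  rw [Finset.ssubset_iff]
  refine ⟨i, by simp; omega, ?_⟩
  intro j hj
  simp only [Finset.mem_insert, Finset.mem_filter, Finset.mem_univ, true_and] at hj ⊢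
  rcases hj with rfl | ⟨h1, h2⟩
  · simp
  · exact ⟨h2, by rw [Fin.le_def]; omega⟩

theorem IsSeeded.leaves {F : Finset V} {T b : ℕ} {a : Fin m → V} (h : IsSeeded F T b a)
    {i : Fin m} (hi : b ≤ i.val) (hF : a i ∈ F) : Leaves (fun _ _ => (T : ℝ)) a i := by
  classical
  unfold Leaves keptUsers
  refine lt_of_le_of_lt (Finset.sup_le fun j hj => ?_) (h.lt_userRank hi hF)
  simpa using (Finset.mem_filter.1 hj).2.2

theorem IsSeeded.notMem_of_balanced {F : Finset V} {T b : ℕ} {a : Fin m → V}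
    (h : IsSeeded F T b a) (hb : BalancedState (fun _ _ => (T : ℝ)) a) {i : Fin m}
    (hi : b ≤ i.val) : a i ∉ F :=
  fun hF => not_leaves_of_balanced hb i (h.leaves hi hF)

theorem IsSeeded.congr {F : Finset V} {T b : ℕ} {a a' : Fin m → V}
    (h : IsSeeded F T b a) (ha : ∀ i : Fin m, i.val < b → a' i = a i) : IsSeeded F T b a' where
  mem i hi := by rw [ha i hi]; exact h.mem i hi
  card u hu := by
    rw [← h.card u hu]
    congr 1
    ext i
    simp only [Set.mem_ofPred_eq]
    exact and_congr_right fun hi => by rw [ha i hi]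

/-- Every finite set of resources can be filled up to level `T` with the first users, the other
users being put on one resource `v`. -/
theorem exists_isSeeded (F : Finset V) (T m : ℕ) (hm : F.card * T ≤ m) (v : V) :
    ∃ a : Fin m → V, IsSeeded F T (F.card * T) a ∧
      ∀ i : Fin m, F.card * T ≤ i.val → a i = v := by
  classical
  have hdiv : ∀ i : Fin m, i.val < F.card * T → i.val / T < F.card := fun i hi =>
    Nat.div_lt_of_lt_mul (by rwa [mul_comm])
  -- Each block of `T` consecutive indices goes to one resource of `F`.
  let a : Fin m → V := fun i =>
    if h : i.val < F.card * T then (F.equivFin.symm ⟨i.val / T, hdiv i h⟩ : V) else v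
  refine ⟨a, ⟨?_, ?_⟩, ?_⟩
  · intro i hi
    simp only [a, dif_pos hi]
    exact Subtype.property _
  · intro u hu
    set j : Fin F.card := F.equivFin ⟨u, hu⟩ with hj
    have hju : (F.equivFin.symm j : V) = u := by simp [hj]
    rcases Nat.eq_zero_or_pos T with hT | hT
    · subst hT
      simp
    have hset : {i : Fin m | i.val < F.card * T ∧ a i = u} =
        Set.range (fun r : Fin T => (⟨j.val * T + r.val, by
          have h1 : j.val * T + r.val < (j.val + 1) * T := by
            rw [Nat.succ_mul]; omega
          have h2 : (j.val + 1) * T ≤ F.card * T := Nat.mul_le_mul_right _ j.isLt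
          omega⟩ : Fin m)) := by
      ext i
      simp only [Set.mem_ofPred_eq, Set.mem_range]
      constructor
      · rintro ⟨hi, hai⟩
        simp only [a, dif_pos hi] at hai
        rw [← hju] at hai
        have := F.equivFin.symm.injective (Subtype.ext hai)
        have h3 : i.val / T = j.val := by rw [← this]
        refine ⟨⟨i.val % T, Nat.mod_lt _ hT⟩, Fin.ext ?_⟩
        simp only
        rw [← h3, mul_comm]
        exact Nat.div_add_mod _ _
      · rintro ⟨r, rfl⟩
        have h1 : j.val * T + r.val < (j.val + 1) * T := by
          rw [Nat.succ_mul]; omega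
        have h2 : (j.val + 1) * T ≤ F.card * T := Nat.mul_le_mul_right _ j.isLt
        have h3 : (j.val * T + r.val) / T = j.val := by
          rw [mul_comm, Nat.mul_add_div hT, Nat.div_eq_of_lt r.isLt, add_zero]
        refine ⟨by simp only; omega, ?_⟩
        simp only [a]
        rw [dif_pos (by omega)]
        refine Eq.trans ?_ hju
        congr 2
        exact Fin.ext h3
    rw [hset, ← Set.image_univ, Set.ncard_image_of_injective _ ?_]
    · simp
    · intro r r' h
      simpa [Fin.ext_iff] using h
  · intro i hi
    simp only [a]
    rw [dif_neg (by omega)]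

theorem IsSeeded.le_load {F : Finset V} {T b : ℕ} {a : Fin m → V} (h : IsSeeded F T b a)
    {u : V} (hu : u ∈ F) : T ≤ load a u := by
  classical
  rw [← h.card_filter hu]
  unfold load
  apply Finset.card_le_card
  intro j hj
  simp only [Finset.mem_filter, Finset.mem_univ, true_and] at hj ⊢
  exact hj.2

theorem IsSeeded.load_eq {F : Finset V} {T b : ℕ} {a : Fin m → V} (h : IsSeeded F T b a)
    {u : V} (hu : u ∈ F) (hex : ∀ i : Fin m, b ≤ i.val → a i ≠ u) : load a u = T := by
  classical
  rw [← h.card_filter hu]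
  unfold load
  congr 1
  ext j
  simp only [Finset.mem_filter, Finset.mem_univ, true_and]
  exact ⟨fun hj => ⟨by by_contra hc; exact hex j (by omega) hj, hj⟩, fun hj => hj.2⟩

theorem IsSeeded.load_eq_zero {F : Finset V} {T b : ℕ} {a : Fin m → V} (h : IsSeeded F T b a)
    {u : V} (hu : u ∉ F) (hex : ∀ i : Fin m, b ≤ i.val → a i ≠ u) : load a u = 0 := by
  classical
  unfold load
  rw [Finset.card_eq_zero, Finset.filter_eq_empty_iff]
  intro j _ hj
  rcases lt_or_ge j.val b with hb | hb
  · exact hu (hj ▸ h.mem j hb)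
  · exact hex j hb hj

end SeededStates

/-! ### Survival of the extra users on the filled set -/

section SurvivalBound

variable {V : Type*} [Fintype V] [MeasurableSpace V] [MeasurableSingletonClass V] {m : ℕ}
  (G : SimpleGraph V)

theorem integral_neighborLaw {u : V} (hu : (G.neighborSet u).Nonempty) (f : V → ℝ) :
    ∫ w, f w ∂neighborLaw G u = ∑ w, walkMatrix G u w * f w := by
  classical
  unfold neighborLaw
  rw [if_pos hu, integral_fintype Integrable.of_finite]
  apply Finset.sum_congr rfl
  intro w _
  rw [smul_eq_mul]
  congr 1
  rw [Measure.real, ← Set.coe_toFinset (G.neighborSet u), ← Finset.coe_singleton,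
    uniformOn_apply_finset]
  unfold walkMatrix
  have hd : (G.neighborSet u).toFinset.card = G.degree u := by
    rw [Set.toFinset_card, SimpleGraph.card_neighborSet_eq_degree]
  rw [hd]
  split_ifs with h
  · have : (G.neighborSet u).toFinset ∩ {w} = {w} := by
      ext x; simp; rintro rfl; exact h
    rw [this]
    simp
  · have : (G.neighborSet u).toFinset ∩ {w} = ∅ := by
      ext x; simp; rintro hx rfl; exact h hx
    rw [this]
    simp

theorem IsSeeded.ae_protocolLaw {F : Finset V} {T b : ℕ} {a : Fin m → V}
    (h : IsSeeded F T b a) :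
    ∀ᵐ ω ∂protocolLaw G (fun _ _ => (T : ℝ)) a, ∀ t, IsSeeded F T b (ω t) := by
  filter_upwards [protocolLaw_ae_zero G _ a, protocolLaw_ae_stay G _ a] with ω h0 hs t
  induction t with
  | zero => rwa [h0]
  | succ t ih => exact ih.congr fun i hi => hs t i (ih.not_leaves hi)

/-- If `ψ` is supported in `F` and is decreased by at most the factor `ρ` by a step of the walk,
then in every seeded state the probability of being balanced after `t` rounds is bounded as if each
user of index at least `b` had left `F` independently, with probability at most
`1 - ρ ^ t * ψ v` if it started in `v`. -/
theorem IsSeeded.prob_balanced_le {F : Finset V} {T b : ℕ} {a : Fin m → V}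
    (h : IsSeeded F T b a) {ψ : V → ℝ} {ρ : ℝ} (hψ0 : ∀ u, 0 ≤ ψ u) (hψ1 : ∀ u, ψ u ≤ 1)
    (hoff : ∀ u ∉ F, ψ u = 0) (hnb : ∀ u ∈ F, (G.neighborSet u).Nonempty)
    (hstep : ∀ u ∈ F, ρ * ψ u ≤ ∑ w, walkMatrix G u w * ψ w) (hρ0 : 0 ≤ ρ) (hρ1 : ρ ≤ 1)
    (t : ℕ) :
    protocolLaw G (fun _ _ => (T : ℝ)) a {ω | BalancedState (fun _ _ => (T : ℝ)) (ω t)} ≤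
      ENNReal.ofReal (∏ i : Fin m, if b ≤ i.val then 1 - ρ ^ t * ψ (a i) else 1) := by
  classical
  have hle : ∀ t u, ρ ^ t * ψ u ≤ 1 := fun t u =>
    mul_le_one₀ (pow_le_one₀ hρ0 hρ1) (hψ0 u) (hψ1 u)
  -- The factor of user `i` with `t` rounds to go; seeds contribute `1`.
  let φ : ℕ → Fin m → V → ℝ := fun t i x => if b ≤ i.val then 1 - ρ ^ t * ψ x else 1
  have hφ0 : ∀ t i x, 0 ≤ φ t i x := by
    intro t i x
    simp only [φ]
    split_ifs
    · linarith [hle t x]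
    · norm_num
  let u : ℕ → (Fin m → V) → ℝ≥0∞ := fun t c => ENNReal.ofReal (∏ i, φ t i (c i))
  have hu : ∀ t, ∀ c ∈ {c : Fin m → V | IsSeeded F T b c},
      ∫⁻ c', u t c' ∂roundKernel G (fun _ _ => (T : ℝ)) c ≤ u (t + 1) c := by
    intro t c hc
    -- Given the current state the users move independently, so the expectation of the product
    -- factorises.
    rw [roundKernel_apply, ← ofReal_integral_eq_lintegral_ofReal Integrable.of_finite
      (Filter.Eventually.of_forall fun c' => Finset.prod_nonneg fun i _ => hφ0 t i _),
      integral_fintype_prod_eq_prod]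
    apply ENNReal.ofReal_le_ofReal
    apply Finset.prod_le_prod
    · intro i _
      exact integral_nonneg fun x => hφ0 t i x
    intro i _
    simp only [φ]
    split_ifs with hi
    · by_cases hF : c i ∈ F
      · unfold moveLaw
        rw [if_pos (hc.leaves hi hF), integral_sub Integrable.of_finite Integrable.of_finite,
          integral_const_mul, integral_const, probReal_univ, one_smul,
          integral_neighborLaw G (hnb _ hF), pow_succ, mul_assoc]
        have := mul_le_mul_of_nonneg_left (hstep _ hF) (pow_nonneg hρ0 t)
        linarith
      -- Off `F` the user may stay or leave, depending on the load; the factor is already `1` there,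
      -- so the trivial bound suffices.
      · rw [hoff _ hF]
        calc ∫ x, (1 - ρ ^ t * ψ x) ∂moveLaw G (fun _ _ => (T : ℝ)) c i
            ≤ ∫ _, (1 : ℝ) ∂moveLaw G (fun _ _ => (T : ℝ)) c i := by
              apply integral_mono Integrable.of_finite Integrable.of_finite
              intro x
              have := mul_nonneg (pow_nonneg hρ0 t) (hψ0 x)
              simp only
              linarith
          _ = _ := by simp
    · simp
  have hmeas : MeasurableSet {ω : ℕ → (Fin m → V) |
      BalancedState (fun _ _ => (T : ℝ)) (ω t)} := by
    have h : Measurable fun ω : ℕ → (Fin m → V) => ω t := measurable_pi_apply t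
    exact h (MeasurableSet.of_discrete (s := {b | BalancedState (fun _ _ => (T : ℝ)) b}))
  refine le_trans ?_ (lintegral_protocolLaw_le G _ a _ (h.ae_protocolLaw G) u hu t)
  rw [← lintegral_indicator_one hmeas]
  apply lintegral_mono_ae
  filter_upwards [h.ae_protocolLaw G] with ω hω
  by_cases hb : BalancedState (fun _ _ => (T : ℝ)) (ω t)
  · have : u 0 (ω t) = 1 := by
      simp only [u, φ]
      rw [Finset.prod_eq_one, ENNReal.ofReal_one]
      intro i _
      split_ifs with hi
      · rw [hoff _ ((hω t).notMem_of_balanced hb hi)]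
        simp
      · rfl
    rw [this]
    exact Set.indicator_le_self' (by simp) _
  · simp [hb]

/-- Many users that leave the filled part `F` at rate at most `x` each take expected time of
order `log m / x`. -/
theorem IsSeeded.le_expectedRounds {F : Finset V} {T b : ℕ} {a : Fin m → V}
    (h : IsSeeded F T b a) {v : V} (hv : ∀ i : Fin m, b ≤ i.val → a i = v)
    {ψ : V → ℝ} {x : ℝ} (hx : 0 < x) (hψ0 : ∀ u, 0 ≤ ψ u) (hψ1 : ∀ u, ψ u ≤ 1)
    (hoff : ∀ u ∉ F, ψ u = 0) (hnb : ∀ u ∈ F, (G.neighborSet u).Nonempty)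
    (hstep : ∀ u ∈ F, Real.exp (-x) * ψ u ≤ ∑ w, walkMatrix G u w * ψ w)
    (hm : 1 ≤ m) (hb : b ≤ m) (hmany : √(m : ℝ) ≤ ((m - b : ℕ) : ℝ) * ψ v) :
    ENNReal.ofReal (Real.log m / (8 * x)) ≤ expectedRounds G (fun _ _ => (T : ℝ)) a := by
  have hm' : (1 : ℝ) ≤ m := by exact_mod_cast hm
  have hlog : 0 ≤ Real.log m := Real.log_nonneg hm'
  -- With this `t` the survival factor `exp (-x) ^ t` is at least `m ^ (-1/4)`. By `hmany` the
  -- expected number of survivors is then bounded below by `m ^ (1/4) ≥ 1`, and balance has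
  -- probability at most `exp (-1) ≤ 1/2`.
  set t : ℕ := ⌊Real.log m / (4 * x)⌋₊ with ht
  have ht1 : (t : ℝ) ≤ Real.log m / (4 * x) := Nat.floor_le (by positivity)
  have ht2 : Real.log m / (4 * x) < t + 1 := Nat.lt_floor_add_one _
  have htx : t * x ≤ Real.log m / 4 := by
    rw [le_div_iff₀ (by positivity)] at ht1
    linarith
  have hbal : protocolLaw G (fun _ _ => (T : ℝ)) a
      {ω | BalancedState (fun _ _ => (T : ℝ)) (ω t)} ≤ 1 / 2 := by
    refine le_trans (h.prob_balanced_le G hψ0 hψ1 hoff hnb hstep (Real.exp_nonneg _)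
      (Real.exp_le_one_iff.2 (by linarith)) t) ?_
    have hprod : (∏ i : Fin m, if b ≤ i.val then 1 - Real.exp (-x) ^ t * ψ (a i) else 1) =
        (1 - Real.exp (-x) ^ t * ψ v) ^ (m - b) := by
      rw [Finset.prod_ite]
      simp only [Finset.prod_const_one, mul_one]
      rw [Finset.prod_congr rfl (g := fun _ => 1 - Real.exp (-x) ^ t * ψ v)]
      · rw [Finset.prod_const]
        congr 1
        have h1 := Finset.card_filter_add_card_filter_not (s := (Finset.univ : Finset (Fin m)))
          (fun i => b ≤ i.val)
        have h2 : (Finset.univ.filter fun i : Fin m => ¬ b ≤ i.val).card = b := by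
          simp only [not_le]
          rw [Fin.card_filter_val_lt]
          omega
        rw [h2, Finset.card_univ, Fintype.card_fin] at h1
        omega
      · intro i hi
        rw [hv i (Finset.mem_filter.1 hi).2]
    rw [hprod]
    set p := Real.exp (-x) ^ t * ψ v with hp
    have hp1 : p ≤ 1 := mul_le_one₀ (pow_le_one₀ (Real.exp_nonneg _)
      (Real.exp_le_one_iff.2 (by linarith))) (hψ0 v) (hψ1 v)
    have hexp : Real.exp (-(Real.log m / 4)) ≤ Real.exp (-x) ^ t := by
      rw [← Real.exp_nat_mul]
      apply Real.exp_le_exp.2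
      linarith
    have hW : 1 ≤ ((m - b : ℕ) : ℝ) * p := by
      calc (1 : ℝ) ≤ Real.exp (Real.log m / 4) := Real.one_le_exp (by positivity)
        _ = Real.exp (-(Real.log m / 4)) * √(m : ℝ) := by
          rw [Real.sqrt_eq_rpow, Real.rpow_def_of_pos (by linarith), ← Real.exp_add]
          ring_nf
        _ ≤ Real.exp (-x) ^ t * (((m - b : ℕ) : ℝ) * ψ v) := by gcongr
        _ = _ := by rw [hp]; ring
    have hle : (1 - p) ^ (m - b) ≤ 1 / 2 := by
      calc (1 - p) ^ (m - b) ≤ Real.exp (-p) ^ (m - b) := by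
            apply pow_le_pow_left₀ (by linarith)
            linarith [Real.add_one_le_exp (-p)]
        _ = Real.exp (-(((m - b : ℕ) : ℝ) * p)) := by rw [← Real.exp_nat_mul]; ring_nf
        _ ≤ Real.exp (-1) := Real.exp_le_exp.2 (by linarith)
        _ ≤ 1 / 2 := by
          have := Real.exp_one_gt_d9
          rw [Real.exp_neg, inv_eq_one_div]
          apply one_div_le_one_div_of_le <;> linarith
    calc ENNReal.ofReal ((1 - p) ^ (m - b)) ≤ ENNReal.ofReal (1 / 2) :=
          ENNReal.ofReal_le_ofReal hle
      _ = 1 / 2 := by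
        rw [ENNReal.ofReal_div_of_pos (by norm_num)]
        simp
  refine le_trans ?_ (_root_.le_expectedRounds G _ a t hbal)
  have : ((t + 1 : ℕ) : ℝ≥0∞) / 2 = ENNReal.ofReal (((t : ℝ) + 1) / 2) := by
    rw [ENNReal.ofReal_div_of_pos (by norm_num)]
    congr 1
    · rw [← ENNReal.ofReal_natCast]
      push_cast
      rfl
    · simp
  rw [this]
  apply ENNReal.ofReal_le_ofReal
  have : Real.log m / (8 * x) = Real.log m / (4 * x) / 2 := by
    field_simp
    ring
  rw [this]
  linarith

end SurvivalBound

/-! ### Degrees and one-step estimates in joined cliques -/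

section JoinedCliques

variable {V : Type*} [Fintype V] {G : SimpleGraph V} {V₁ V₂ : Finset V} {k : ℕ}

theorem walkMatrix_apply_of_adj [DecidableRel G.Adj] {u w : V} (h : G.Adj u w) :
    walkMatrix G u w = 1 / (G.degree u : ℝ) := by
  unfold walkMatrix
  rw [if_pos h]
  congr!

theorem walkMatrix_apply_of_not_adj {u w : V} (h : ¬ G.Adj u w) : walkMatrix G u w = 0 := by
  unfold walkMatrix
  rw [if_neg h]

theorem sum_walkMatrix_mul [DecidableRel G.Adj] (u : V) (f : V → ℝ) :
    ∑ w, walkMatrix G u w * f w = (∑ w ∈ G.neighborFinset u, f w) / G.degree u := by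
  rw [Finset.sum_div, ← Finset.sum_subset (Finset.subset_univ (G.neighborFinset u))]
  · apply Finset.sum_congr rfl
    intro w hw
    rw [walkMatrix_apply_of_adj ((G.mem_neighborFinset u w).1 hw)]
    ring
  · intro w _ hw
    rw [walkMatrix_apply_of_not_adj (by simpa using hw), zero_mul]

theorem sum_degreeInto_comm {V : Type*} (G : SimpleGraph V) (V₁ V₂ : Finset V) :
    ∑ v ∈ V₁, degreeInto G V₂ v = ∑ v ∈ V₂, degreeInto G V₁ v := by
  classical
  unfold degreeInto
  simp only [Finset.card_filter]
  rw [Finset.sum_comm]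
  simp only [G.adj_comm]

theorem degreeInto_le_card {V : Type*} (G : SimpleGraph V) (W : Finset V) (v : V) :
    degreeInto G W v ≤ W.card := by
  classical
  exact Finset.card_filter_le _ _

namespace IsJoinedCliques

theorem symm (h : IsJoinedCliques G V₁ V₂ k) : IsJoinedCliques G V₂ V₁ k where
  disjoint := h.disjoint.symm
  cover v := (h.cover v).symm
  card_eq := h.card_eq.symm
  clique₁ := h.clique₂
  clique₂ := h.clique₁
  cut := by rw [← sum_degreeInto_comm, h.cut]
  even₁ := h.even₂
  even₂ := h.even₁

theorem card (h : IsJoinedCliques G V₁ V₂ k) : Fintype.card V = 2 * V₁.card := by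
  classical
  have : (Finset.univ : Finset V) = V₁ ∪ V₂ := by
    ext v
    simpa using h.cover v
  rw [← Finset.card_univ, this, Finset.card_union_of_disjoint h.disjoint, ← h.card_eq, two_mul]

/-- Cliques with at most one vertex would give `n ^ 2 ≤ 4 < 5 * k`. -/
theorem two_le_card (h : IsJoinedCliques G V₁ V₂ k) (hk : 1 ≤ k)
    (hk' : 5 * k ≤ Fintype.card V ^ 2) : 2 ≤ V₁.card := by
  rw [h.card] at hk'
  by_contra hc
  have : V₁.card ≤ 1 := by omega
  interval_cases V₁.card <;> omega

theorem neighborFinset_eq [DecidableEq V] [DecidableRel G.Adj] (h : IsJoinedCliques G V₁ V₂ k)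
    {u : V} (hu : u ∈ V₁) :
    G.neighborFinset u = V₁.erase u ∪ V₂.filter fun w => G.Adj u w := by
  ext w
  simp only [SimpleGraph.mem_neighborFinset, Finset.mem_union, Finset.mem_erase,
    Finset.mem_filter]
  constructor
  · intro hw
    rcases h.cover w with h1 | h2
    · exact Or.inl ⟨hw.ne', h1⟩
    · exact Or.inr ⟨h2, hw⟩
  · rintro (⟨h1, h2⟩ | ⟨_, h2⟩)
    · exact h.clique₁ hu h2 h1.symm
    · exact h2

theorem degree_add_one [DecidableRel G.Adj] (h : IsJoinedCliques G V₁ V₂ k) {u : V}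
    (hu : u ∈ V₁) : G.degree u + 1 = V₁.card + degreeInto G V₂ u := by
  classical
  have h1 : (V₁.erase u).card + 1 = V₁.card := Finset.card_erase_add_one hu
  have h2 : G.degree u = (V₁.erase u).card + degreeInto G V₂ u := by
    have e := congrArg Finset.card (h.neighborFinset_eq hu)
    rw [Finset.card_union_of_disjoint ((h.disjoint.mono_left (Finset.erase_subset _ _)).mono_right
      (Finset.filter_subset _ _)), SimpleGraph.card_neighborFinset_eq_degree] at e
    rw [e]
    unfold degreeInto
    congr!
  omega

theorem card_le_degree_add_one [DecidableRel G.Adj] (h : IsJoinedCliques G V₁ V₂ k) (u : V) :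
    V₁.card ≤ G.degree u + 1 := by
  rcases h.cover u with hu | hu
  · rw [h.degree_add_one hu]; omega
  · rw [h.symm.degree_add_one hu, h.card_eq]; omega

theorem degree_lt_two_mul_card [DecidableRel G.Adj] (h : IsJoinedCliques G V₁ V₂ k) (u : V) :
    G.degree u + 1 ≤ 2 * V₁.card := by
  rcases h.cover u with hu | hu
  · rw [h.degree_add_one hu]
    have := degreeInto_le_card G V₂ u
    rw [← h.card_eq] at this
    omega
  · rw [h.symm.degree_add_one hu]
    have := degreeInto_le_card G V₁ u
    rw [← h.card_eq]
    omega

/-- By averaging: if all cross degrees exceeded the floor, they would add up to more than `k`. -/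
theorem exists_degreeInto_eq (h : IsJoinedCliques G V₁ V₂ k) (h0 : 0 < V₁.card) :
    ∃ v ∈ V₁, degreeInto G V₂ v = k / V₁.card := by
  by_contra! hc
  have h1 : ∑ v ∈ V₁, (k / V₁.card + 1) ≤ k := by
    calc ∑ v ∈ V₁, (k / V₁.card + 1) ≤ ∑ v ∈ V₁, degreeInto G V₂ v :=
          Finset.sum_le_sum fun v hv =>
            Nat.succ_le_of_lt (lt_of_le_of_ne (h.even₁ v hv).1 (hc v hv).symm)
      _ = k := h.cut
  rw [Finset.sum_const, smul_eq_mul] at h1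
  exact absurd h1 (not_le.2 (Nat.lt_mul_div_succ k h0))

end IsJoinedCliques

/-- Turns a leak `y` into an exponential rate. The inequality with `1 - y` fails for large `y`;
there the bound `1 / 3` is met by cruder estimates. The cases split at `y = 2 / 3`, where `(1 + 3 *
y) * (1 - y) = 1` and `1 + 3 * y = 3`. -/
theorem exp_neg_three_mul_le (y : ℝ) (hy : 0 ≤ y) :
    Real.exp (-(3 * y)) ≤ 1 / 3 ∨ Real.exp (-(3 * y)) ≤ 1 - y := by
  rcases le_or_gt y (2 / 3) with h | h
  · right
    have h1 : 0 < 1 - y := by linarith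
    rw [Real.exp_neg, inv_le_comm₀ (Real.exp_pos _) h1]
    have := Real.add_one_le_exp (3 * y)
    refine le_trans ?_ this
    rw [inv_le_iff_one_le_mul₀ h1]
    nlinarith
  · left
    rw [Real.exp_neg, inv_le_comm₀ (Real.exp_pos _) (by norm_num)]
    have := Real.add_one_le_exp (3 * y)
    norm_num
    linarith

open Classical in
/-- The probability to stay in the clique `V₁` in one step, as a function of the position; it is
`0` outside `V₁`. -/
noncomputable def stayProb (G : SimpleGraph V) (V₁ : Finset V) (u : V) : ℝ :=
  if u ∈ V₁ then ((V₁.card : ℝ) - 1) / G.degree u else 0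

namespace IsJoinedCliques

theorem degree_pos [DecidableRel G.Adj] (h : IsJoinedCliques G V₁ V₂ k) (hN : 2 ≤ V₁.card)
    (u : V) : 0 < G.degree u := by
  have := h.card_le_degree_add_one u
  omega

theorem neighborSet_nonempty (h : IsJoinedCliques G V₁ V₂ k) (hN : 2 ≤ V₁.card) (u : V) :
    (G.neighborSet u).Nonempty := by
  classical
  obtain ⟨w, hw⟩ := (G.degree_pos_iff_exists_adj u).1 (h.degree_pos hN u)
  exact ⟨w, hw⟩

theorem stayProb_bounds (h : IsJoinedCliques G V₁ V₂ k) (hN : 2 ≤ V₁.card) {u : V}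
    (hu : u ∈ V₁) : 1 / 3 ≤ stayProb G V₁ u ∧ stayProb G V₁ u ≤ 1 := by
  classical
  have h1 : (V₁.card : ℝ) ≤ G.degree u + 1 := by exact_mod_cast h.card_le_degree_add_one u
  have h2 : (G.degree u : ℝ) + 1 ≤ 2 * V₁.card := by exact_mod_cast h.degree_lt_two_mul_card u
  have h3 : (2 : ℝ) ≤ V₁.card := by exact_mod_cast hN
  have h4 : (0 : ℝ) < G.degree u := by exact_mod_cast h.degree_pos hN u
  unfold stayProb
  rw [if_pos hu]
  constructor
  · rw [le_div_iff₀ h4]; linarith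
  · rw [div_le_one h4]; linarith

/-- A step inside the clique is uniform on `V₁.erase u`, so the next exit probability is an average
over the clique, of order `k / N ^ 2` with `N = V₁.card`. The indicator of `V₁` in place of
`stayProb` would only see the worst vertex, whose exit probability is `1 / N` if `k < N`. -/
theorem stayProb_step (h : IsJoinedCliques G V₁ V₂ k) (hN : 2 ≤ V₁.card) {u : V}
    (hu : u ∈ V₁) :
    Real.exp (-(3 * (k / ((V₁.card : ℝ) - 1) ^ 2))) * stayProb G V₁ u ≤
      ∑ w, walkMatrix G u w * stayProb G V₁ w := by
  classical
  have hN' : (2 : ℝ) ≤ V₁.card := by exact_mod_cast hN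
  have hdu : (0 : ℝ) < G.degree u := by exact_mod_cast h.degree_pos hN u
  have hsum : (∑ w, walkMatrix G u w * stayProb G V₁ w) =
      (∑ w ∈ V₁.erase u, stayProb G V₁ w) / G.degree u := by
    rw [sum_walkMatrix_mul, h.neighborFinset_eq hu, Finset.sum_union, add_eq_left.2]
    · apply Finset.sum_eq_zero
      intro w hw
      unfold stayProb
      rw [if_neg (Finset.disjoint_right.1 h.disjoint (Finset.mem_filter.1 hw).1)]
    · exact (h.disjoint.mono_left (Finset.erase_subset _ _)).mono_right
        (Finset.filter_subset _ _)
  have hcard : ((V₁.erase u).card : ℝ) = V₁.card - 1 := by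
    rw [Finset.card_erase_of_mem hu, Nat.cast_sub (by omega), Nat.cast_one]
  have hmain : Real.exp (-(3 * (k / ((V₁.card : ℝ) - 1) ^ 2))) * (V₁.card - 1) ≤
      ∑ w ∈ V₁.erase u, stayProb G V₁ w := by
    -- For a large leak `stayProb ≥ 1 / 3` suffices; otherwise the cross degrees are summed to at
    -- most `k`.
    rcases exp_neg_three_mul_le (k / ((V₁.card : ℝ) - 1) ^ 2) (by positivity) with he | he
    · calc _ ≤ 1 / 3 * ((V₁.card : ℝ) - 1) := by
            apply mul_le_mul_of_nonneg_right he; linarith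
        _ = ∑ w ∈ V₁.erase u, (1 / 3 : ℝ) := by
            rw [Finset.sum_const, nsmul_eq_mul, hcard]; ring
        _ ≤ _ := Finset.sum_le_sum fun w hw =>
            (h.stayProb_bounds hN (Finset.mem_of_mem_erase hw)).1
    · calc _ ≤ (1 - k / ((V₁.card : ℝ) - 1) ^ 2) * ((V₁.card : ℝ) - 1) := by
            apply mul_le_mul_of_nonneg_right he; linarith
        _ = ((V₁.card : ℝ) - 1) - k / ((V₁.card : ℝ) - 1) := by
            have : (V₁.card : ℝ) - 1 ≠ 0 := by linarith
            field_simp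
        _ ≤ ∑ w ∈ V₁.erase u, (1 - (degreeInto G V₂ w : ℝ) / ((V₁.card : ℝ) - 1)) := by
            rw [Finset.sum_sub_distrib, Finset.sum_const, nsmul_eq_mul, hcard, mul_one,
              ← Finset.sum_div]
            apply sub_le_sub_left
            apply div_le_div_of_nonneg_right _ (by linarith)
            calc ∑ w ∈ V₁.erase u, (degreeInto G V₂ w : ℝ)
                ≤ ∑ w ∈ V₁, (degreeInto G V₂ w : ℝ) :=
                  Finset.sum_le_sum_of_subset_of_nonneg (Finset.erase_subset _ _)
                    fun _ _ _ => Nat.cast_nonneg _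
              _ = k := by exact_mod_cast h.cut
        _ ≤ _ := by
            apply Finset.sum_le_sum
            intro w hw
            have hw1 := Finset.mem_of_mem_erase hw
            have hdw : (0 : ℝ) < G.degree w := by exact_mod_cast h.degree_pos hN w
            have hd : (G.degree w : ℝ) + 1 = V₁.card + degreeInto G V₂ w := by
              exact_mod_cast h.degree_add_one hw1
            have hle : (V₁.card : ℝ) - 1 ≤ G.degree w := by
              have : (V₁.card : ℝ) ≤ G.degree w + 1 := by
                exact_mod_cast h.card_le_degree_add_one w
              linarith
            unfold stayProb
            rw [if_pos hw1]
            have e : ((V₁.card : ℝ) - 1) / G.degree w =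
                1 - (degreeInto G V₂ w : ℝ) / G.degree w := by
              field_simp
              linarith
            rw [e]
            apply sub_le_sub_left
            apply div_le_div_of_nonneg_left (Nat.cast_nonneg _) (by linarith) hle
  rw [hsum, le_div_iff₀ hdu]
  have e : stayProb G V₁ u * G.degree u = (V₁.card : ℝ) - 1 := by
    unfold stayProb
    rw [if_pos hu]
    field_simp
  rw [mul_assoc, e]
  exact hmain

theorem sum_walkMatrix (h : IsJoinedCliques G V₁ V₂ k) (hN : 2 ≤ V₁.card) (u : V) :
    ∑ w, walkMatrix G u w = 1 := by
  classical
  have := sum_walkMatrix_mul (G := G) u (fun _ => 1)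
  simp only [mul_one, Finset.sum_const, nsmul_eq_mul] at this
  rw [this, SimpleGraph.card_neighborFinset_eq_degree, div_self]
  exact_mod_cast (h.degree_pos hN u).ne'

/-- There is a vertex such that the walk misses it in every step with probability at least
`exp (-6 / N)`. -/
theorem exists_missed_vertex (h : IsJoinedCliques G V₁ V₂ k) (hN : 2 ≤ V₁.card) (hk : 1 ≤ k) :
    ∃ w, ∀ u ≠ w, Real.exp (-(6 / (V₁.card : ℝ))) ≤ 1 - walkMatrix G u w := by
  classical
  -- The missed vertex `w` is chosen in `V₁` different from an endpoint `w'` of a cut edge. Then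
  -- every neighbour of `w` has degree at least `2`, even if the cliques have two vertices, and no
  -- step to `w` is forced.
  obtain ⟨w', hw', hd'⟩ : ∃ w' ∈ V₁, 0 < degreeInto G V₂ w' := by
    by_contra! hc
    have : ∑ v ∈ V₁, degreeInto G V₂ v = 0 :=
      Finset.sum_eq_zero fun v hv => Nat.le_zero.1 (hc v hv)
    rw [h.cut] at this
    omega
  obtain ⟨w, hw, hne⟩ := Finset.exists_mem_ne (by omega : 1 < V₁.card) w'
  have hN' : (2 : ℝ) ≤ V₁.card := by exact_mod_cast hN
  refine ⟨w, fun u hu => ?_⟩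
  by_cases hadj : G.Adj u w
  · have hdeg : 2 ≤ G.degree u := by
      rcases h.cover u with h1 | h2
      · have hd := h.degree_add_one h1
        by_cases huw : u = w'
        · subst huw
          omega
        · have : ({u, w, w'} : Finset V).card ≤ V₁.card := by
            apply Finset.card_le_card
            intro x hx
            simp only [Finset.mem_insert, Finset.mem_singleton] at hx
            rcases hx with rfl | rfl | rfl <;> assumption
          rw [Finset.card_eq_three.2 ⟨u, w, w', hu, huw, hne, rfl⟩] at this
          omega
      · have hd := h.symm.degree_add_one h2
        have : 0 < degreeInto G V₁ u := by
          unfold degreeInto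
          rw [Finset.card_pos]
          exact ⟨w, Finset.mem_filter.2 ⟨hw, hadj⟩⟩
        have := h.card_eq
        omega
    have hdeg' : (2 : ℝ) ≤ G.degree u := by exact_mod_cast hdeg
    have hd1 : (V₁.card : ℝ) ≤ G.degree u + 1 := by exact_mod_cast h.card_le_degree_add_one u
    rw [walkMatrix_apply_of_adj hadj]
    -- The degree is at least `N - 1` and at least `2`, hence at least `N / 2`.
    have hle : Real.exp (-(6 / (V₁.card : ℝ))) ≤ Real.exp (-(3 * (1 / (G.degree u : ℝ)))) := by
      apply Real.exp_le_exp.2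
      apply neg_le_neg
      rw [mul_one_div, div_le_div_iff₀ (by linarith) (by linarith)]
      linarith
    refine hle.trans ?_
    rcases exp_neg_three_mul_le (1 / (G.degree u : ℝ)) (by positivity) with he | he
    · refine he.trans ?_
      have : 1 / (G.degree u : ℝ) ≤ 1 / 2 := one_div_le_one_div_of_le (by norm_num) hdeg'
      linarith
    · exact he
  · rw [walkMatrix_apply_of_not_adj hadj, sub_zero]
    apply Real.exp_le_one_iff.2
    have : 0 ≤ 6 / (V₁.card : ℝ) := by positivity
    linarith

end IsJoinedCliques

end JoinedCliques

/-! ### The two slow initial states -/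

section LowerBounds

variable {n k m : ℕ} {G : SimpleGraph (Fin n)} {V₁ V₂ : Finset (Fin n)}

theorem div_le_averageLoad (m n : ℕ) : (m : ℝ) / n ≤ averageLoad m n := Nat.le_ceil _

theorem averageLoad_lt (m n : ℕ) : (averageLoad m n : ℝ) < (m : ℝ) / n + 1 :=
  Nat.ceil_lt_add_one (by positivity)

/-- If the clique `V₁` is filled exactly except for one vertex, which takes all other users, then
the number of rounds is at least of the order `n ^ 2 / k * log m`. -/
theorem IsJoinedCliques.exists_clique_state (h : IsJoinedCliques G V₁ V₂ k) (hk : 1 ≤ k)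
    (hk' : 5 * k ≤ n ^ 2) {ε : ℝ} (hε : ε ≤ 1 / 2) (hm : 144 * (n : ℝ) ≤ m)
    {T : ℕ} (hT : T = ⌈(1 + ε) * (averageLoad m n : ℝ)⌉₊) :
    ∃ (v : Fin n) (a : Fin m → Fin n),
      v ∈ V₁ ∧ degreeInto G V₂ v = k / (n / 2) ∧
      (∀ u ∈ V₁, u ≠ v → load a u = T) ∧ T ≤ load a v ∧ (∀ u ∈ V₂, load a u = 0) ∧
      ENNReal.ofReal (1 / 384 * ((n : ℝ) ^ 2 / k) * Real.log m) ≤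
        expectedRounds G (fun _ _ => (T : ℝ)) a := by
  have hN : 2 ≤ V₁.card := h.two_le_card hk (by simpa using hk')
  have hn : n = 2 * V₁.card := by simpa using h.card
  have hN' : (2 : ℝ) ≤ V₁.card := by exact_mod_cast hN
  have hn' : (n : ℝ) = 2 * V₁.card := by exact_mod_cast hn
  have hn0 : (0 : ℝ) < n := by linarith
  have hk0 : (1 : ℝ) ≤ k := by exact_mod_cast hk
  have hm576 : (576 : ℝ) ≤ m := by linarith
  have hT1 : (T : ℝ) ≤ 3 / 2 * ((m : ℝ) / n + 1) + 1 := by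
    -- `ε` is bounded only from above here; for `1 + ε < 0` the ceiling in `ℕ` is `0`.
    rcases le_or_gt 0 (1 + ε) with h0 | h0
    · have h1 : (T : ℝ) < (1 + ε) * (averageLoad m n : ℝ) + 1 := by
        rw [hT]
        exact Nat.ceil_lt_add_one (mul_nonneg h0 (Nat.cast_nonneg _))
      have h2 := averageLoad_lt m n
      have h3 : (1 + ε) * (averageLoad m n : ℝ) ≤ 3 / 2 * ((m : ℝ) / n + 1) :=
        mul_le_mul (by linarith) h2.le (Nat.cast_nonneg _) (by norm_num)
      linarith
    · have : T = 0 := by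
        rw [hT, Nat.ceil_eq_zero]
        exact mul_nonpos_of_nonpos_of_nonneg h0.le (Nat.cast_nonneg _)
      rw [this, Nat.cast_zero]
      positivity
  -- The seeds number at most `3 / 4 * m + 5 / 4 * n`, and `n ≤ m / 144`; at least `m / 8` users are
  -- extra.
  have hb : ((V₁.card * T : ℕ) : ℝ) ≤ 7 / 8 * m := by
    push_cast
    calc (V₁.card : ℝ) * T ≤ V₁.card * (3 / 2 * ((m : ℝ) / n + 1) + 1) := by gcongr
      _ = 3 / 4 * m + 5 / 4 * n := by
        rw [hn']
        field_simp
        ring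
      _ ≤ _ := by linarith
  have hbm : V₁.card * T ≤ m := by
    have : ((V₁.card * T : ℕ) : ℝ) ≤ m := by linarith
    exact_mod_cast this
  obtain ⟨v, hv, hdv⟩ := h.exists_degreeInto_eq (by omega)
  obtain ⟨a, ha, hav⟩ := exists_isSeeded V₁ T m hbm v
  refine ⟨v, a, hv, by rw [hdv]; congr 1; omega, fun u hu huv => ?_, ha.le_load hv,
    fun u hu => ?_, ?_⟩
  · exact ha.load_eq hu fun i hi => by rw [hav i hi]; exact huv.symm
  · have hu1 : u ∉ V₁ := Finset.disjoint_right.1 h.disjoint hu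
    exact ha.load_eq_zero hu1 fun i hi hiu => hu1 (by rwa [← hiu, hav i hi])
  have hy : 0 < 3 * ((k : ℝ) / ((V₁.card : ℝ) - 1) ^ 2) := by
    have : (0 : ℝ) < (V₁.card : ℝ) - 1 := by linarith
    positivity
  -- The extra users, weighted by `ψ v ≥ 1 / 3`, count at least `m / 24`, and `m ≥ 576 = 24 ^ 2`.
  have hsq : √(m : ℝ) * 24 ≤ m := by
    have h24 : (24 : ℝ) ≤ √(m : ℝ) := Real.le_sqrt_of_sq_le (by linarith [show (24 : ℝ) ^ 2 = 576 by norm_num])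
    calc √(m : ℝ) * 24 ≤ √(m : ℝ) * √(m : ℝ) := by gcongr
      _ = m := Real.mul_self_sqrt (by linarith)
  have hE := ha.le_expectedRounds G hav hy (ψ := stayProb G V₁)
    (fun u => by
      by_cases hu : u ∈ V₁
      · linarith [(h.stayProb_bounds hN hu).1]
      · simp [stayProb, hu])
    (fun u => by
      by_cases hu : u ∈ V₁
      · exact (h.stayProb_bounds hN hu).2
      · simp [stayProb, hu])
    (fun u hu => by simp [stayProb, hu])
    (fun u _ => h.neighborSet_nonempty hN u)
    (fun u hu => h.stayProb_step hN hu)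
    (by
      have : (1 : ℝ) ≤ m := by linarith
      exact_mod_cast this) hbm
    (by
      have h1 : (m : ℝ) / 8 ≤ ((m - V₁.card * T : ℕ) : ℝ) := by
        rw [Nat.cast_sub hbm]
        linarith
      calc √(m : ℝ) ≤ m / 8 * (1 / 3) := by linarith
        _ ≤ _ := by
          apply mul_le_mul h1 (h.stayProb_bounds hN hv).1 (by norm_num) (Nat.cast_nonneg _))
  refine le_trans (ENNReal.ofReal_le_ofReal ?_) hE
  have hlog : 0 ≤ Real.log m := Real.log_nonneg (by linarith)
  -- Since `N - 1 ≥ N / 2 = n / 4`, the constant is `8 * 3 * 16 = 384`.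
  have hx : 8 * (3 * ((k : ℝ) / ((V₁.card : ℝ) - 1) ^ 2)) ≤ 384 * (k / (n : ℝ) ^ 2) := by
    rw [hn']
    have h1 : (0 : ℝ) < (V₁.card : ℝ) - 1 := by linarith
    have : (k : ℝ) / ((V₁.card : ℝ) - 1) ^ 2 ≤ k / ((V₁.card : ℝ) / 2) ^ 2 := by
      apply div_le_div_of_nonneg_left (by positivity) (by positivity)
      apply pow_le_pow_left₀ (by positivity)
      linarith
    calc _ ≤ 8 * (3 * ((k : ℝ) / ((V₁.card : ℝ) / 2) ^ 2)) := by linarith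
      _ = _ := by field_simp; ring
  calc 1 / 384 * ((n : ℝ) ^ 2 / k) * Real.log m = Real.log m / (384 * (k / (n : ℝ) ^ 2)) := by
        field_simp
    _ ≤ _ := div_le_div_of_nonneg_left hlog (by linarith) hx

/-- If all vertices but one are filled exactly, and the exceptional one is empty, then the number
of rounds is at least of the order `n * log m`. -/
theorem IsJoinedCliques.exists_hole_state (h : IsJoinedCliques G V₁ V₂ k) (hk : 1 ≤ k)
    (hk' : 5 * k ≤ n ^ 2) (hm : 4 * (n : ℝ) ^ 2 ≤ m) {T : ℕ} (hT : T = averageLoad m n + 1) :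
    ∃ a : Fin m → Fin n,
      ENNReal.ofReal ((n : ℝ) * Real.log m / 96) ≤ expectedRounds G (fun _ _ => (T : ℝ)) a := by
  classical
  have hN : 2 ≤ V₁.card := h.two_le_card hk (by simpa using hk')
  have hn : n = 2 * V₁.card := by simpa using h.card
  have hN' : (2 : ℝ) ≤ V₁.card := by exact_mod_cast hN
  have hn' : (n : ℝ) = 2 * V₁.card := by exact_mod_cast hn
  have hn0 : (4 : ℝ) ≤ n := by linarith
  have hm1 : (1 : ℝ) ≤ m := by nlinarith
  obtain ⟨w, hw⟩ := h.exists_missed_vertex hN hk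
  set F : Finset (Fin n) := Finset.univ.erase w with hF
  have hFc : F.card = n - 1 := by
    rw [hF, Finset.card_erase_of_mem (Finset.mem_univ _), Finset.card_univ, Fintype.card_fin]
  have hFc' : (F.card : ℝ) = n - 1 := by
    rw [hFc, Nat.cast_sub (by omega), Nat.cast_one]
  obtain ⟨v, hv⟩ : F.Nonempty := Finset.card_pos.1 (by omega)
  have hT1 : (T : ℝ) ≤ (m : ℝ) / n + 2 := by
    rw [hT]
    push_cast
    linarith [averageLoad_lt m n]
  have hmn : 2 * (n : ℝ) ≤ m / n / 2 := by
    rw [div_div, le_div_iff₀ (by positivity)]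
    nlinarith
  -- The rounding in `T` costs at most `2 * (n - 1)` users, at most half of the share `m / n` of the
  -- hole; so `m / (2 * n)` users are extra, which is at least `√m` because `m ≥ 4 * n ^ 2`.
  have hb : ((F.card * T : ℕ) : ℝ) ≤ m - m / n / 2 := by
    push_cast
    rw [hFc']
    calc ((n : ℝ) - 1) * T ≤ (n - 1) * ((m : ℝ) / n + 2) :=
          mul_le_mul_of_nonneg_left hT1 (by linarith)
      _ = m - m / n + 2 * (n - 1) := by field_simp
      _ ≤ _ := by linarith
  have hmn0 : 0 ≤ (m : ℝ) / n / 2 := by positivity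
  have hbm : F.card * T ≤ m := by
    have : ((F.card * T : ℕ) : ℝ) ≤ m := by linarith
    exact_mod_cast this
  obtain ⟨a, ha, hav⟩ := exists_isSeeded F T m hbm v
  refine ⟨a, ?_⟩
  have hE := ha.le_expectedRounds G hav (x := 6 / (V₁.card : ℝ)) (by positivity)
    (ψ := fun u => if u ∈ F then 1 else 0)
    (fun u => by split_ifs <;> norm_num) (fun u => by split_ifs <;> norm_num)
    (fun u hu => by simp [hu]) (fun u _ => h.neighborSet_nonempty hN u)
    (fun u hu => by
      have h1 : (∑ x, walkMatrix G u x * (if x ∈ F then (1 : ℝ) else 0)) =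
          1 - walkMatrix G u w := by
        simp only [mul_ite, mul_one, mul_zero, Finset.sum_ite_mem, Finset.univ_inter]
        rw [hF, Finset.sum_erase_eq_sub (Finset.mem_univ w), h.sum_walkMatrix hN]
      rw [h1, if_pos hu, mul_one]
      exact hw u (Finset.ne_of_mem_erase hu))
    (by exact_mod_cast hm1) hbm
    (by
      rw [if_pos hv, mul_one, Nat.cast_sub hbm]
      have h1 : 2 * (n : ℝ) ≤ √(m : ℝ) := Real.le_sqrt_of_sq_le (by nlinarith)
      have h2 : √(m : ℝ) ≤ m / n / 2 := by
        rw [div_div, le_div_iff₀ (by positivity)]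
        calc √(m : ℝ) * (n * 2) ≤ √(m : ℝ) * √(m : ℝ) :=
              mul_le_mul_of_nonneg_left (by linarith) (Real.sqrt_nonneg _)
          _ = m := Real.mul_self_sqrt (by linarith)
      linarith)
  refine le_trans (le_of_eq ?_) hE
  congr 1
  rw [hn']
  field_simp
  ring

end LowerBounds

/-! ### Non-emptiness of the class -/

section Construction

/-- Two cliques on copies of `A`, with an edge from `a` to `b` between them if `R a b`. -/
def joinedCliques {A : Type*} (R : A → A → Prop) : SimpleGraph (A ⊕ A) where
  Adj
    | .inl a, .inl b => a ≠ b
    | .inr a, .inr b => a ≠ b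
    | .inl a, .inr b => R a b
    | .inr b, .inl a => R a b
  symm := ⟨by
    rintro (a | a) (b | b) h
    · exact fun e => h e.symm
    · exact h
    · exact h
    · exact fun e => h e.symm⟩
  loopless := ⟨by
    rintro (a | a) h
    · exact h rfl
    · exact h rfl⟩

theorem isJoinedCliques_of_relation {V A : Type*} [Fintype V] [Fintype A] (e : V ≃ A ⊕ A)
    (R : A → A → Prop)
    [DecidableRel R] (k : ℕ)
    (hcut : ∑ a, (Finset.univ.filter fun b => R a b).card = k)
    (hrow : ∀ a, k / Fintype.card A ≤ (Finset.univ.filter fun b => R a b).card ∧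
      (Finset.univ.filter fun b => R a b).card ≤ k ⌈/⌉ Fintype.card A)
    (hcol : ∀ b, k / Fintype.card A ≤ (Finset.univ.filter fun a => R a b).card ∧
      (Finset.univ.filter fun a => R a b).card ≤ k ⌈/⌉ Fintype.card A) :
    IsJoinedCliques ((joinedCliques R).comap e)
      (Finset.univ.map (Function.Embedding.inl.trans e.symm.toEmbedding))
      (Finset.univ.map (Function.Embedding.inr.trans e.symm.toEmbedding)) k := by
  classical
  have h1 : ∀ a, degreeInto ((joinedCliques R).comap e)
      (Finset.univ.map (Function.Embedding.inr.trans e.symm.toEmbedding)) (e.symm (.inl a)) =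
      (Finset.univ.filter fun b => R a b).card := by
    intro a
    unfold degreeInto
    rw [Finset.filter_map, Finset.card_map]
    congr 1
    ext b
    simp [joinedCliques]
  have h2 : ∀ b, degreeInto ((joinedCliques R).comap e)
      (Finset.univ.map (Function.Embedding.inl.trans e.symm.toEmbedding)) (e.symm (.inr b)) =
      (Finset.univ.filter fun a => R a b).card := by
    intro b
    unfold degreeInto
    rw [Finset.filter_map, Finset.card_map]
    congr 1
    ext a
    simp [joinedCliques]
  refine ⟨?_, ?_, ?_, ?_, ?_, ?_, ?_, ?_⟩
  · rw [Finset.disjoint_left]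
    intro v hv hv'
    simp only [Finset.mem_map, Finset.mem_univ, true_and] at hv hv'
    obtain ⟨a, rfl⟩ := hv
    obtain ⟨b, hb⟩ := hv'
    simp at hb
  · intro v
    obtain ⟨x, rfl⟩ := e.symm.surjective v
    rcases x with a | b
    · left; simp
    · right; simp
  · simp
  · intro u hu v hv huv
    simp only [Finset.coe_map, Set.mem_image, Finset.coe_univ, Set.mem_univ, true_and] at hu hv
    obtain ⟨a, rfl⟩ := hu
    obtain ⟨b, rfl⟩ := hv
    simpa [joinedCliques] using huv
  · intro u hu v hv huv
    simp only [Finset.coe_map, Set.mem_image, Finset.coe_univ, Set.mem_univ, true_and] at hu hv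
    obtain ⟨a, rfl⟩ := hu
    obtain ⟨b, rfl⟩ := hv
    simpa [joinedCliques] using huv
  · rw [Finset.sum_map, ← hcut]
    exact Finset.sum_congr rfl fun a _ => h1 a
  · intro v hv
    simp only [Finset.mem_map, Finset.mem_univ, true_and] at hv
    obtain ⟨a, rfl⟩ := hv
    rw [Finset.card_map, Finset.card_univ]
    exact (h1 a).symm ▸ hrow a
  · intro v hv
    simp only [Finset.mem_map, Finset.mem_univ, true_and] at hv
    obtain ⟨b, rfl⟩ := hv
    rw [Finset.card_map, Finset.card_univ]
    exact (h2 b).symm ▸ hcol b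

/-- One number is taken from each block `[d * N, (d + 1) * N)`. Blocks with `d < k / N` lie entirely
below `k`, and those with `d ≥ k ⌈/⌉ N` entirely at or above it. -/
theorem card_filter_mul_add_lt {N k : ℕ} (hk : k ≤ N * N) (c : Fin N → Fin N) :
    k / N ≤ (Finset.univ.filter fun d : Fin N => d.val * N + (c d).val < k).card ∧
      (Finset.univ.filter fun d : Fin N => d.val * N + (c d).val < k).card ≤ k ⌈/⌉ N := by
  rcases Nat.eq_zero_or_pos N with rfl | hN
  · simp
  have hq : k / N ≤ N := Nat.div_le_of_le_mul hk
  constructor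
  · have h1 : (Finset.univ.filter fun d : Fin N => d.val < k / N).card = k / N := by
      rw [Fin.card_filter_val_lt, min_eq_right hq]
    rw [← h1]
    apply Finset.card_le_card
    intro d hd
    simp only [Finset.mem_filter, Finset.mem_univ, true_and] at hd ⊢
    have h2 : (d.val + 1) * N ≤ k / N * N := Nat.mul_le_mul_right _ hd
    have h3 : k / N * N ≤ k := Nat.div_mul_le_self k N
    have := (c d).isLt
    rw [Nat.succ_mul] at h2
    omega
  · have h1 : (Finset.univ.filter fun d : Fin N => d.val < k ⌈/⌉ N).card ≤ k ⌈/⌉ N := by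
      rw [Fin.card_filter_val_lt]
      exact min_le_right _ _
    refine le_trans (Finset.card_le_card ?_) h1
    intro d hd
    simp only [Finset.mem_filter, Finset.mem_univ, true_and] at hd ⊢
    by_contra hc
    rw [not_lt, ceilDiv_le_iff_le_mul hN, mul_comm] at hc
    omega

theorem card_filter_equiv {A B : Type*} [Fintype A] [Fintype B] (f : A ≃ B) (p : B → Prop)
    [DecidablePred p] :
    (Finset.univ.filter fun d => p (f d)).card = (Finset.univ.filter p).card := by
  rw [← Finset.card_map f.toEmbedding]
  congr 1
  ext x
  simp only [Finset.mem_map, Finset.mem_filter, Finset.mem_univ, true_and]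
  constructor
  · rintro ⟨d, hd, rfl⟩
    exact hd
  · intro hx
    exact ⟨f.symm x, by simpa using hx, by simp⟩

/-- The pairs `(a, b)` are ordered by the cyclic difference `b - a`, then by `a`, and the first `k`
of them become edges. Each difference class is a perfect matching, so at every moment the degrees
differ by at most one. -/
theorem exists_isJoinedCliques (N k : ℕ) (hN : 0 < N) (hk : k ≤ N * N) :
    ∃ (G : SimpleGraph (Fin (2 * N))) (V₁ V₂ : Finset (Fin (2 * N))),
      IsJoinedCliques G V₁ V₂ k := by
  have : NeZero N := ⟨hN.ne'⟩
  have hrow : ∀ a : Fin N, (Finset.univ.filter fun b : Fin N =>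
      (b - a).val * N + a.val < k).card =
      (Finset.univ.filter fun d : Fin N => d.val * N + a.val < k).card := fun a =>
    card_filter_equiv (Equiv.subRight a) fun d => d.val * N + a.val < k
  have hcol : ∀ b : Fin N, (Finset.univ.filter fun a : Fin N =>
      (b - a).val * N + a.val < k).card =
      (Finset.univ.filter fun d : Fin N => d.val * N + (b - d).val < k).card := by
    intro b
    rw [← card_filter_equiv (Equiv.subLeft b) fun d => d.val * N + (b - d).val < k]
    simp
  refine ⟨_, _, _, isJoinedCliques_of_relation
    ((finCongr (two_mul N)).trans finSumFinEquiv.symm)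
    (fun a b : Fin N => (b - a).val * N + a.val < k) k ?_ ?_ ?_⟩
  · simp only [hrow]
    have hprod : ∑ a : Fin N, (Finset.univ.filter fun d : Fin N => d.val * N + a.val < k).card =
        (Finset.univ.filter fun x : Fin N × Fin N => x.1.val * N + x.2.val < k).card := by
      simp only [Finset.card_filter]
      rw [Finset.sum_comm, ← Finset.univ_product_univ, Finset.sum_product]
    rw [hprod, ← Finset.card_map finProdFinEquiv.toEmbedding]
    have : (Finset.univ.filter fun x : Fin N × Fin N => x.1.val * N + x.2.val < k).map
        finProdFinEquiv.toEmbedding =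
        Finset.univ.filter fun x : Fin (N * N) => x.val < k := by
      ext x
      obtain ⟨y, rfl⟩ := finProdFinEquiv.surjective x
      simp only [Finset.mem_map_equiv, Equiv.symm_apply_apply, Finset.mem_filter,
        Finset.mem_univ, true_and, finProdFinEquiv_apply_val]
      rw [add_comm, mul_comm]
    rw [this, Fin.card_filter_val_lt, min_eq_right hk]
  · intro a
    simp only [Fintype.card_fin]
    rw [hrow a]
    exact card_filter_mul_add_lt hk fun _ => a
  · intro b
    simp only [Fintype.card_fin]
    rw [hcol b]
    exact card_filter_mul_add_lt hk fun d => b - d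

end Construction

/-! ### The spectral gap is of order `k / n ^ 2` -/

section SpectralGap

variable {V : Type*} [Fintype V] {G : SimpleGraph V} {V₁ V₂ : Finset V} {k : ℕ}

/-! ### Generalities on the gap -/

theorem finite_setOf_abs_eigenvalue (G : SimpleGraph V) :
    {r : ℝ | ∃ lam : ℝ, Module.End.HasEigenvalue (walkMatrix G).mulVecLin lam ∧ |lam| < 1 ∧
      r = |lam|}.Finite := by
  have h := (Module.End.finite_hasEigenvalue (walkMatrix G).mulVecLin).image (fun x => |x|)
  refine h.subset ?_
  rintro r ⟨lam, h1, _, rfl⟩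
  exact ⟨lam, h1, rfl⟩

/-- Only finitely many eigenvalues enter, each of absolute value below `1`, so the supremum is
attained or the set is empty, with `sSup ∅ = 0`. -/
theorem walkGap_pos (G : SimpleGraph V) : 0 < walkGap G := by
  unfold walkGap
  rw [sub_pos]
  rcases Set.eq_empty_or_nonempty {r : ℝ | ∃ lam : ℝ,
    Module.End.HasEigenvalue (walkMatrix G).mulVecLin lam ∧ |lam| < 1 ∧ r = |lam|} with h | h
  · rw [h, Real.sSup_empty]
    norm_num
  · obtain ⟨lam, _, h1, h2⟩ := h.csSup_mem (finite_setOf_abs_eigenvalue G)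
    rw [h2]
    exact h1

theorem walkGap_le_one (G : SimpleGraph V) : walkGap G ≤ 1 := by
  unfold walkGap
  rw [sub_le_self_iff]
  apply Real.sSup_nonneg
  rintro r ⟨lam, _, _, rfl⟩
  exact abs_nonneg _

theorem walkGap_le_of_hasEigenvalue {lam : ℝ}
    (h : Module.End.HasEigenvalue (walkMatrix G).mulVecLin lam) (h1 : |lam| < 1) :
    walkGap G ≤ 1 - |lam| := by
  unfold walkGap
  apply sub_le_sub_left
  exact le_csSup (finite_setOf_abs_eigenvalue G).bddAbove ⟨lam, h, h1, rfl⟩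

theorem le_walkGap {δ : ℝ} (hδ : δ ≤ 1)
    (h : ∀ lam : ℝ, Module.End.HasEigenvalue (walkMatrix G).mulVecLin lam → |lam| < 1 →
      |lam| ≤ 1 - δ) : δ ≤ walkGap G := by
  unfold walkGap
  rw [le_sub_comm]
  apply Real.sSup_le
  · rintro r ⟨lam, h1, h2, rfl⟩
    exact h lam h1 h2
  · linarith

/-! ### Quadratic forms -/

open Classical in
/-- The entries of the adjacency matrix. -/
noncomputable def adjWeight {V : Type*} (G : SimpleGraph V) (u w : V) : ℝ := if G.Adj u w then 1 else 0

theorem adjWeight_nonneg {V : Type*} {G : SimpleGraph V} (u w : V) : 0 ≤ adjWeight G u w := by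
  unfold adjWeight
  split_ifs <;> norm_num

theorem adjWeight_comm {V : Type*} {G : SimpleGraph V} (u w : V) :
    adjWeight G u w = adjWeight G w u := by
  unfold adjWeight
  rw [G.adj_comm u w]

theorem sum_adjWeight_eq_degreeInto {V : Type*} {G : SimpleGraph V} (W : Finset V) (u : V) :
    ∑ w ∈ W, adjWeight G u w = degreeInto G W u := by
  unfold adjWeight degreeInto
  simp

theorem sum_adjWeight [DecidableRel G.Adj] (u : V) : ∑ w, adjWeight G u w = G.degree u := by
  rw [sum_adjWeight_eq_degreeInto, ← SimpleGraph.card_neighborFinset_eq_degree]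
  unfold degreeInto
  congr 2
  ext w
  simp

theorem walkMatrix_eq_adjWeight_div [DecidableRel G.Adj] (u w : V) :
    walkMatrix G u w = adjWeight G u w / G.degree u := by
  by_cases h : G.Adj u w
  · rw [walkMatrix_apply_of_adj h]
    simp [adjWeight, h]
  · rw [walkMatrix_apply_of_not_adj h]
    simp [adjWeight, h]

/-- The Dirichlet form of the graph. -/
noncomputable def dirichletForm (G : SimpleGraph V) (f : V → ℝ) : ℝ :=
  ∑ u, ∑ w, adjWeight G u w * (f u - f w) ^ 2

theorem dirichletForm_nonneg (f : V → ℝ) : 0 ≤ dirichletForm G f :=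
  Finset.sum_nonneg fun u _ => Finset.sum_nonneg fun w _ =>
    mul_nonneg (adjWeight_nonneg u w) (sq_nonneg _)

/-- The sign `s = -1` gives the Dirichlet form, which controls eigenvalues near `1`; `s = 1` gives
the signless form for eigenvalues near `-1`. -/
theorem sum_adjWeight_mul_add_sq [DecidableRel G.Adj] (f : V → ℝ) (s : ℝ) (hs : s ^ 2 = 1) :
    ∑ u, ∑ w, adjWeight G u w * (f u + s * f w) ^ 2 =
      2 * (∑ u, (G.degree u : ℝ) * f u ^ 2 + s * ∑ u, f u * ∑ w, adjWeight G u w * f w) := by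
  have h1 : ∑ u, ∑ w, adjWeight G u w * f u ^ 2 = ∑ u, (G.degree u : ℝ) * f u ^ 2 := by
    apply Finset.sum_congr rfl
    intro u _
    rw [← Finset.sum_mul, sum_adjWeight]
  have h2 : ∑ u, ∑ w, adjWeight G u w * f w ^ 2 = ∑ u, (G.degree u : ℝ) * f u ^ 2 := by
    rw [Finset.sum_comm, ← h1]
    simp only [adjWeight_comm]
  have h3 : ∑ u, ∑ w, adjWeight G u w * (f u + s * f w) ^ 2 =
      ∑ u, ∑ w, adjWeight G u w * f u ^ 2 + ∑ u, ∑ w, adjWeight G u w * f w ^ 2 +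
        2 * s * ∑ u, f u * ∑ w, adjWeight G u w * f w := by
    simp only [Finset.mul_sum, ← Finset.sum_add_distrib]
    apply Finset.sum_congr rfl
    intro u _
    apply Finset.sum_congr rfl
    intro w _
    linear_combination adjWeight G u w * f w ^ 2 * hs
  rw [h3, h1, h2]
  ring

theorem dirichletForm_eq [DecidableRel G.Adj] (f : V → ℝ) :
    dirichletForm G f =
      2 * (∑ u, (G.degree u : ℝ) * f u ^ 2 - ∑ u, f u * ∑ w, adjWeight G u w * f w) := by
  have := sum_adjWeight_mul_add_sq (G := G) f (-1) (by norm_num)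
  simp only [neg_mul, one_mul, ← sub_eq_add_neg] at this
  exact this

theorem Module.End.HasEigenvalue.exists_mulVec_eq {A : Matrix V V ℝ} {lam : ℝ}
    (h : Module.End.HasEigenvalue A.mulVecLin lam) :
    ∃ f : V → ℝ, f ≠ 0 ∧ A.mulVec f = lam • f := by
  obtain ⟨f, hf⟩ := h.exists_hasEigenvector
  exact ⟨f, hf.2, by simpa using hf.apply_eq_smul⟩

section Eigenvectors

variable [DecidableRel G.Adj] {f : V → ℝ} {lam : ℝ}

theorem sum_adjWeight_mul_of_eigenvector (hd : ∀ u, 0 < G.degree u)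
    (hf : (walkMatrix G).mulVec f = lam • f) (u : V) :
    ∑ w, adjWeight G u w * f w = lam * (G.degree u * f u) := by
  have h := congrFun hf u
  simp only [Matrix.mulVec, dotProduct, walkMatrix_eq_adjWeight_div, Pi.smul_apply, smul_eq_mul]
    at h
  have hu : (G.degree u : ℝ) ≠ 0 := by exact_mod_cast (hd u).ne'
  rw [mul_left_comm, ← h, Finset.mul_sum]
  apply Finset.sum_congr rfl
  intro w _
  field_simp

theorem dirichletForm_of_eigenvector (hd : ∀ u, 0 < G.degree u)
    (hf : (walkMatrix G).mulVec f = lam • f) :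
    dirichletForm G f = 2 * (1 - lam) * ∑ u, (G.degree u : ℝ) * f u ^ 2 := by
  rw [dirichletForm_eq]
  simp only [sum_adjWeight_mul_of_eigenvector hd hf]
  have : ∑ u, f u * (lam * (G.degree u * f u)) = lam * ∑ u, (G.degree u : ℝ) * f u ^ 2 := by
    rw [Finset.mul_sum]
    exact Finset.sum_congr rfl fun u _ => by ring
  rw [this]
  ring

theorem sum_adjWeight_mul_add_sq_of_eigenvector (hd : ∀ u, 0 < G.degree u)
    (hf : (walkMatrix G).mulVec f = lam • f) :
    ∑ u, ∑ w, adjWeight G u w * (f u + f w) ^ 2 =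
      2 * (1 + lam) * ∑ u, (G.degree u : ℝ) * f u ^ 2 := by
  have h := sum_adjWeight_mul_add_sq (G := G) f 1 (by norm_num)
  simp only [one_mul, sum_adjWeight_mul_of_eigenvector hd hf] at h
  have : ∑ u, f u * (lam * (G.degree u * f u)) = lam * ∑ u, (G.degree u : ℝ) * f u ^ 2 := by
    rw [Finset.mul_sum]
    exact Finset.sum_congr rfl fun u _ => by ring
  rw [h, this]
  ring

/-- The degree measure is stationary, so applying the walk preserves the weighted sum, while it also
multiplies it by `lam`. -/
theorem sum_degree_mul_eq_zero_of_eigenvector (hd : ∀ u, 0 < G.degree u)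
    (hf : (walkMatrix G).mulVec f = lam • f) (h1 : lam ≠ 1) :
    ∑ u, (G.degree u : ℝ) * f u = 0 := by
  have h : ∑ u, (G.degree u : ℝ) * f u = lam * ∑ u, (G.degree u : ℝ) * f u := by
    calc ∑ u, (G.degree u : ℝ) * f u = ∑ u, ∑ w, adjWeight G w u * f u := by
          apply Finset.sum_congr rfl
          intro u _
          simp only [adjWeight_comm (G := G) _ u]
          rw [← Finset.sum_mul, sum_adjWeight]
      _ = ∑ w, ∑ u, adjWeight G w u * f u := Finset.sum_comm
      _ = _ := by
          rw [Finset.mul_sum]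
          exact Finset.sum_congr rfl fun w _ => sum_adjWeight_mul_of_eigenvector hd hf w
  have h2 : (1 - lam) * ∑ u, (G.degree u : ℝ) * f u = 0 := by linarith
  rcases mul_eq_zero.1 h2 with h3 | h3
  · exact absurd (by linarith) h1
  · exact h3

theorem sum_degree_mul_sq_pos (hd : ∀ u, 0 < G.degree u) (hf : f ≠ 0) :
    0 < ∑ u, (G.degree u : ℝ) * f u ^ 2 := by
  obtain ⟨u, hu⟩ := Function.ne_iff.1 hf
  apply Finset.sum_pos' (fun u _ => by positivity)
  refine ⟨u, Finset.mem_univ _, ?_⟩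
  have h1 : (0 : ℝ) < G.degree u := by exact_mod_cast hd u
  have h2 : f u ≠ 0 := hu
  positivity

/-- A lower bound `r` for the Rayleigh quotient of `f` gives an eigenvalue that is at least `r` and
has an eigenvector to which `f` is not orthogonal. -/
theorem exists_eigenvector_of_rayleigh (hd : ∀ u, 0 < G.degree u) (hf : f ≠ 0) {r : ℝ}
    (hr : r * ∑ u, (G.degree u : ℝ) * f u ^ 2 ≤ ∑ u, f u * ∑ w, adjWeight G u w * f w) :
    ∃ (lam : ℝ) (g : V → ℝ), r ≤ lam ∧ g ≠ 0 ∧ (walkMatrix G).mulVec g = lam • g ∧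
      ∑ u, (G.degree u : ℝ) * (f u * g u) ≠ 0 := by
  classical
  obtain ⟨s, hs, hss⟩ : ∃ s : V → ℝ, (∀ u, 0 < s u) ∧ ∀ u, s u * s u = G.degree u :=
    ⟨fun u => √(G.degree u : ℝ), fun u => Real.sqrt_pos.2 (by exact_mod_cast hd u), fun u =>
      Real.mul_self_sqrt (Nat.cast_nonneg _)⟩
  -- The walk matrix is conjugate, by square roots of degrees, to this symmetric matrix. The vector
  -- `h` is `f` after the conjugation, and `c` holds its coordinates in the eigenbasis.
  let S : Matrix V V ℝ := fun u w =>
    adjWeight G u w / (s u * s w)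
  have hS : S.IsHermitian := by
    refine Matrix.IsHermitian.ext fun u w => ?_
    simp only [S, star_trivial]
    rw [adjWeight_comm, mul_comm]
  let b := hS.eigenvectorBasis
  let h : V → ℝ := fun u => s u * f u
  let c : V → ℝ := fun i => ∑ u, b i u * h u
  have hb : ∀ i u, ∑ w, S u w * b i w = hS.eigenvalues i * b i u := fun i u => by
    have := congrFun (hS.mulVec_eigenvectorBasis i) u
    simpa [Matrix.mulVec, dotProduct] using this
  have hcS : ∀ i, ∑ u, b i u * ∑ w, S u w * h w = hS.eigenvalues i * c i := by
    intro i
    calc ∑ u, b i u * ∑ w, S u w * h w = ∑ u, ∑ w, b i u * (S u w * h w) := by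
          simp only [Finset.mul_sum]
      _ = ∑ w, ∑ u, b i u * (S u w * h w) := Finset.sum_comm
      _ = ∑ w, (∑ u, S w u * b i u) * h w := by
          apply Finset.sum_congr rfl
          intro w _
          rw [Finset.sum_mul]
          apply Finset.sum_congr rfl
          intro u _
          have : S u w = S w u := by
            have := hS.apply w u
            simpa using this
          rw [this]
          ring
      _ = _ := by
          simp only [hb, c]
          rw [Finset.mul_sum]
          exact Finset.sum_congr rfl fun w _ => by ring
  have hparseval : ∀ y : V → ℝ, ∑ i, c i * (∑ u, b i u * y u) = ∑ u, h u * y u := by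
    intro y
    have := b.sum_inner_mul_inner (WithLp.toLp 2 h) (WithLp.toLp 2 y)
    simp only [PiLp.inner_apply, RCLike.inner_apply, conj_trivial] at this
    rw [show ∑ u, h u * y u = ∑ u, y u * h u from Finset.sum_congr rfl fun u _ => mul_comm _ _,
      ← this]
    apply Finset.sum_congr rfl
    intro i _
    simp only [c]
    congr 1
    exact Finset.sum_congr rfl fun u _ => mul_comm _ _
  have hn : ∑ i, c i * c i = ∑ u, (G.degree u : ℝ) * f u ^ 2 := by
    rw [hparseval h]
    apply Finset.sum_congr rfl
    intro u _
    simp only [h]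
    rw [← hss u]
    ring
  have hq : ∑ i, c i * (hS.eigenvalues i * c i) = ∑ u, f u * ∑ w, adjWeight G u w * f w := by
    simp only [← hcS]
    rw [hparseval]
    apply Finset.sum_congr rfl
    intro u _
    simp only [h, S, Finset.mul_sum]
    apply Finset.sum_congr rfl
    intro w _
    have := (hs u).ne'
    have := (hs w).ne'
    field_simp
  -- Otherwise all terms of `∑ i, (eigenvalue i - r) * c i ^ 2` are nonpositive while the sum is
  -- nonnegative, which forces `c = 0` and hence `f = 0`.
  obtain ⟨i, hi, hci⟩ : ∃ i, r ≤ hS.eigenvalues i ∧ c i ≠ 0 := by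
    by_contra! hcon
    have h0 : 0 ≤ ∑ i, (hS.eigenvalues i - r) * (c i * c i) := by
      have : ∑ i, (hS.eigenvalues i - r) * (c i * c i) =
          ∑ i, c i * (hS.eigenvalues i * c i) - r * ∑ i, c i * c i := by
        rw [Finset.mul_sum, ← Finset.sum_sub_distrib]
        exact Finset.sum_congr rfl fun i _ => by ring
      rw [this, hq, hn]
      linarith
    have hle : ∀ i ∈ Finset.univ, (hS.eigenvalues i - r) * (c i * c i) ≤ 0 := by
      intro i _
      rcases le_or_gt r (hS.eigenvalues i) with hri | hri
      · rw [hcon i hri]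
        simp
      · exact mul_nonpos_of_nonpos_of_nonneg (by linarith) (mul_self_nonneg _)
    have hz := (Finset.sum_eq_zero_iff_of_nonpos hle).1 (le_antisymm (Finset.sum_nonpos hle) h0)
    have : ∑ i, c i * c i = 0 := by
      apply Finset.sum_eq_zero
      intro i hi
      rcases le_or_gt r (hS.eigenvalues i) with hri | hri
      · rw [hcon i hri]
        simp
      · rcases mul_eq_zero.1 (hz i hi) with h1 | h1
        · linarith
        · exact h1
    rw [hn] at this
    exact (sum_degree_mul_sq_pos hd hf).ne' this
  have hcg : ∑ u, (G.degree u : ℝ) * (f u * (b i u / s u)) = c i := by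
    apply Finset.sum_congr rfl
    intro u _
    simp only [h]
    rw [← hss u]
    have := (hs u).ne'
    field_simp
  refine ⟨hS.eigenvalues i, fun u => b i u / s u, hi, ?_, ?_, ?_⟩
  · intro hg
    apply hci
    rw [← hcg]
    apply Finset.sum_eq_zero
    intro u _
    have : b i u / s u = 0 := congrFun hg u
    rw [this]
    simp
  · ext u
    simp only [Matrix.mulVec, dotProduct, Pi.smul_apply, smul_eq_mul]
    rw [← mul_div_assoc, ← hb i u, Finset.sum_div]
    apply Finset.sum_congr rfl
    intro w _
    rw [walkMatrix_eq_adjWeight_div, ← hss u]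
    simp only [S]
    have := (hs u).ne'
    have := (hs w).ne'
    field_simp
  · rw [hcg]
    exact hci

end Eigenvectors

/-! ### Eigenvalue estimates for joined cliques -/

namespace IsJoinedCliques

theorem sum_univ (h : IsJoinedCliques G V₁ V₂ k) (F : V → ℝ) :
    ∑ v, F v = ∑ v ∈ V₁, F v + ∑ v ∈ V₂, F v := by
  classical
  rw [← Finset.sum_union h.disjoint]
  congr 1
  ext v
  simpa using h.cover v

theorem adjWeight_eq_one (h : IsJoinedCliques G V₁ V₂ k) {u w : V} (hu : u ∈ V₁) (hw : w ∈ V₁)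
    (huw : u ≠ w) : adjWeight G u w = 1 := by
  unfold adjWeight
  rw [if_pos (h.clique₁ hu hw huw)]

theorem dirichletForm_eq_blocks (h : IsJoinedCliques G V₁ V₂ k) (f : V → ℝ) :
    dirichletForm G f = ∑ u ∈ V₁, ∑ w ∈ V₁, (f u - f w) ^ 2 +
      ∑ u ∈ V₂, ∑ w ∈ V₂, (f u - f w) ^ 2 +
      2 * ∑ u ∈ V₁, ∑ w ∈ V₂, adjWeight G u w * (f u - f w) ^ 2 := by
  have block : ∀ {V₁ V₂ : Finset V}, IsJoinedCliques G V₁ V₂ k →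
      ∑ u ∈ V₁, ∑ w ∈ V₁, adjWeight G u w * (f u - f w) ^ 2 =
        ∑ u ∈ V₁, ∑ w ∈ V₁, (f u - f w) ^ 2 := by
    intro V₁ V₂ h
    apply Finset.sum_congr rfl
    intro u hu
    apply Finset.sum_congr rfl
    intro w hw
    by_cases huw : u = w
    · simp [huw]
    · rw [h.adjWeight_eq_one hu hw huw, one_mul]
  have hcross : ∑ u ∈ V₂, ∑ w ∈ V₁, adjWeight G u w * (f u - f w) ^ 2 =
      ∑ u ∈ V₁, ∑ w ∈ V₂, adjWeight G u w * (f u - f w) ^ 2 := by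
    rw [Finset.sum_comm]
    apply Finset.sum_congr rfl
    intro u _
    apply Finset.sum_congr rfl
    intro w _
    rw [adjWeight_comm]
    ring
  unfold dirichletForm
  simp only [h.sum_univ, Finset.sum_add_distrib]
  rw [block h, block h.symm, hcross]
  ring

theorem sum_sum_mul_degreeInto_le (h : IsJoinedCliques G V₁ V₂ k) (f : V → ℝ) :
    ∑ u ∈ V₁, ∑ x ∈ V₁, (degreeInto G V₂ x : ℝ) * (f u - f x) ^ 2 ≤
      V₁.card * ∑ u ∈ V₁, ∑ x ∈ V₁, (f u - f x) ^ 2 := by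
  simp only [Finset.mul_sum]
  apply Finset.sum_le_sum
  intro u _
  apply Finset.sum_le_sum
  intro x _
  apply mul_le_mul_of_nonneg_right _ (sq_nonneg _)
  rw [h.card_eq]
  exact_mod_cast degreeInto_le_card G V₂ x

/-- Every pair `u`, `w` is joined through every cut edge `x y` by the path `u, x, y, w`, and the
square of the sum of three increments is at most three times the sum of squares. Summed over pairs
and edges, each kind of increment is used at most `N ^ 2` times, because cross degrees are at most
`N`. -/
theorem cut_mul_le (h : IsJoinedCliques G V₁ V₂ k) (f : V → ℝ) :
    k * ∑ u ∈ V₁, ∑ w ∈ V₂, (f u - f w) ^ 2 ≤ 3 * (V₁.card : ℝ) ^ 2 * dirichletForm G f := by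
  set N : ℝ := (V₁.card : ℝ) with hN
  have hN2 : (V₂.card : ℝ) = N := by rw [hN, h.card_eq]
  have hN0 : 0 ≤ N := Nat.cast_nonneg _
  have hk : ∑ x ∈ V₁, ∑ y ∈ V₂, adjWeight G x y = k := by
    simp only [sum_adjWeight_eq_degreeInto]
    exact_mod_cast h.cut
  have hA : ∑ u ∈ V₁, ∑ w ∈ V₂, ∑ x ∈ V₁, ∑ y ∈ V₂, adjWeight G x y * (f u - f x) ^ 2 =
      N * ∑ u ∈ V₁, ∑ x ∈ V₁, (degreeInto G V₂ x : ℝ) * (f u - f x) ^ 2 := by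
    simp only [← Finset.sum_mul, sum_adjWeight_eq_degreeInto, Finset.sum_const, nsmul_eq_mul, hN2]
    rw [Finset.mul_sum]
  have hB : ∑ u ∈ V₁, ∑ w ∈ V₂, ∑ x ∈ V₁, ∑ y ∈ V₂, adjWeight G x y * (f x - f y) ^ 2 =
      N ^ 2 * ∑ x ∈ V₁, ∑ y ∈ V₂, adjWeight G x y * (f x - f y) ^ 2 := by
    simp only [Finset.sum_const, nsmul_eq_mul, hN2, ← hN]
    ring
  have hC : ∑ u ∈ V₁, ∑ w ∈ V₂, ∑ x ∈ V₁, ∑ y ∈ V₂, adjWeight G x y * (f w - f y) ^ 2 =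
      N * ∑ w ∈ V₂, ∑ y ∈ V₂, (degreeInto G V₁ y : ℝ) * (f w - f y) ^ 2 := by
    rw [Finset.sum_const, nsmul_eq_mul, ← hN]
    congr 1
    apply Finset.sum_congr rfl
    intro w _
    rw [Finset.sum_comm]
    apply Finset.sum_congr rfl
    intro y _
    rw [← Finset.sum_mul, ← sum_adjWeight_eq_degreeInto]
    simp only [adjWeight_comm (G := G) _ y]
  have hD : k * ∑ u ∈ V₁, ∑ w ∈ V₂, (f u - f w) ^ 2 ≤
      3 * (∑ u ∈ V₁, ∑ w ∈ V₂, ∑ x ∈ V₁, ∑ y ∈ V₂, adjWeight G x y * (f u - f x) ^ 2 +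
        ∑ u ∈ V₁, ∑ w ∈ V₂, ∑ x ∈ V₁, ∑ y ∈ V₂, adjWeight G x y * (f x - f y) ^ 2 +
        ∑ u ∈ V₁, ∑ w ∈ V₂, ∑ x ∈ V₁, ∑ y ∈ V₂, adjWeight G x y * (f w - f y) ^ 2) := by
    simp only [← Finset.sum_add_distrib]
    rw [← hk]
    simp only [Finset.mul_sum]
    apply Finset.sum_le_sum
    intro u _
    apply Finset.sum_le_sum
    intro w _
    rw [Finset.sum_mul]
    apply Finset.sum_le_sum
    intro x _
    rw [Finset.sum_mul]
    apply Finset.sum_le_sum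
    intro y _
    have h3 : (f u - f w) ^ 2 ≤ 3 * ((f u - f x) ^ 2 + (f x - f y) ^ 2 + (f w - f y) ^ 2) := by
      nlinarith [sq_nonneg ((f u - f x) - (f x - f y)), sq_nonneg ((f x - f y) - (f y - f w)),
        sq_nonneg ((f u - f x) - (f y - f w))]
    have := mul_le_mul_of_nonneg_left h3 (adjWeight_nonneg (G := G) x y)
    linarith
  have h1 := h.sum_sum_mul_degreeInto_le f
  have h2 := h.symm.sum_sum_mul_degreeInto_le f
  rw [← hN] at h1
  rw [hN2] at h2
  rw [hA, hB, hC] at hD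
  rw [h.dirichletForm_eq_blocks]
  have hX : 0 ≤ ∑ x ∈ V₁, ∑ y ∈ V₂, adjWeight G x y * (f x - f y) ^ 2 :=
    Finset.sum_nonneg fun u _ => Finset.sum_nonneg fun w _ =>
      mul_nonneg (adjWeight_nonneg u w) (sq_nonneg _)
  have h1' := mul_le_mul_of_nonneg_left h1 hN0
  have h2' := mul_le_mul_of_nonneg_left h2 hN0
  have hX' := mul_nonneg (sq_nonneg N) hX
  nlinarith

/-- A Poincaré inequality: all pairs of vertices are compared through the edges of the cut. -/
theorem poincare (h : IsJoinedCliques G V₁ V₂ k) (hk : k ≤ V₁.card ^ 2) (f : V → ℝ) :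
    k * ∑ u, ∑ w, (f u - f w) ^ 2 ≤ 7 * (V₁.card : ℝ) ^ 2 * dirichletForm G f := by
  have hk' : (k : ℝ) ≤ (V₁.card : ℝ) ^ 2 := by exact_mod_cast hk
  have h1 := h.cut_mul_le f
  have hcross : ∑ u ∈ V₂, ∑ w ∈ V₁, (f u - f w) ^ 2 = ∑ u ∈ V₁, ∑ w ∈ V₂, (f u - f w) ^ 2 := by
    rw [Finset.sum_comm]
    exact Finset.sum_congr rfl fun u _ => Finset.sum_congr rfl fun w _ => by ring
  simp only [h.sum_univ, Finset.sum_add_distrib]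
  rw [hcross]
  have hX : 0 ≤ ∑ x ∈ V₁, ∑ y ∈ V₂, adjWeight G x y * (f x - f y) ^ 2 :=
    Finset.sum_nonneg fun u _ => Finset.sum_nonneg fun w _ =>
      mul_nonneg (adjWeight_nonneg u w) (sq_nonneg _)
  have h2 : ∑ u ∈ V₁, ∑ w ∈ V₁, (f u - f w) ^ 2 + ∑ u ∈ V₂, ∑ w ∈ V₂, (f u - f w) ^ 2 ≤
      dirichletForm G f := by
    rw [h.dirichletForm_eq_blocks]
    linarith
  -- Pairs inside the cliques cost `k ≤ N ^ 2` Dirichlet forms, cross pairs `3 * N ^ 2` in each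
  -- order: `7 = 1 + 2 * 3`.
  have h3 := mul_le_mul_of_nonneg_left h2 (Nat.cast_nonneg (α := ℝ) k)
  have h4 := mul_le_mul_of_nonneg_right hk' (dirichletForm_nonneg (G := G) f)
  linarith

theorem sum_degree_bounds [DecidableRel G.Adj] (h : IsJoinedCliques G V₁ V₂ k)
    (hN : 2 ≤ V₁.card) : (V₁.card : ℝ) ^ 2 ≤ ∑ u, (G.degree u : ℝ) := by
  have hN' : (2 : ℝ) ≤ V₁.card := by exact_mod_cast hN
  calc (V₁.card : ℝ) ^ 2 ≤ ∑ _u : V, ((V₁.card : ℝ) - 1) := by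
        rw [Finset.sum_const, nsmul_eq_mul, Finset.card_univ, h.card]
        push_cast
        nlinarith
    _ ≤ _ := Finset.sum_le_sum fun u _ => by
        have : (V₁.card : ℝ) ≤ G.degree u + 1 := by exact_mod_cast h.card_le_degree_add_one u
        linarith

/-- The variance identity for a function of mean zero under the degree measure, whose total mass is
at least `N ^ 2`, with degrees at most `2 * N`. -/
theorem sum_degree_mul_sq_le [DecidableRel G.Adj] (h : IsJoinedCliques G V₁ V₂ k)
    (hN : 2 ≤ V₁.card) {f : V → ℝ} (hf : ∑ u, (G.degree u : ℝ) * f u = 0) :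
    ∑ u, (G.degree u : ℝ) * f u ^ 2 ≤ 2 * ∑ u, ∑ w, (f u - f w) ^ 2 := by
  have hN' : (2 : ℝ) ≤ V₁.card := by exact_mod_cast hN
  have e : ∑ u, ∑ w, (G.degree u : ℝ) * G.degree w * (f u - f w) ^ 2 =
      2 * (∑ u, (G.degree u : ℝ)) * ∑ u, (G.degree u : ℝ) * f u ^ 2 := by
    have e1 : ∑ u, ∑ w, (G.degree u : ℝ) * G.degree w * (f u - f w) ^ 2 =
        (∑ u, (G.degree u : ℝ) * f u ^ 2) * (∑ w, (G.degree w : ℝ)) +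
        (∑ u, (G.degree u : ℝ)) * (∑ w, (G.degree w : ℝ) * f w ^ 2) -
        2 * ((∑ u, (G.degree u : ℝ) * f u) * (∑ w, (G.degree w : ℝ) * f w)) := by
      simp only [Finset.sum_mul_sum]
      simp only [Finset.mul_sum, ← Finset.sum_add_distrib, ← Finset.sum_sub_distrib]
      exact Finset.sum_congr rfl fun u _ => Finset.sum_congr rfl fun w _ => by ring
    rw [e1, hf]
    ring
  have hle : ∑ u, ∑ w, (G.degree u : ℝ) * G.degree w * (f u - f w) ^ 2 ≤
      4 * (V₁.card : ℝ) ^ 2 * ∑ u, ∑ w, (f u - f w) ^ 2 := by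
    simp only [Finset.mul_sum]
    apply Finset.sum_le_sum
    intro u _
    apply Finset.sum_le_sum
    intro w _
    apply mul_le_mul_of_nonneg_right _ (sq_nonneg _)
    have hu : (G.degree u : ℝ) + 1 ≤ 2 * V₁.card := by exact_mod_cast h.degree_lt_two_mul_card u
    have hw : (G.degree w : ℝ) + 1 ≤ 2 * V₁.card := by exact_mod_cast h.degree_lt_two_mul_card w
    calc (G.degree u : ℝ) * G.degree w ≤ (2 * V₁.card) * (2 * V₁.card) :=
          mul_le_mul (by linarith) (by linarith) (Nat.cast_nonneg _) (by positivity)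
      _ = _ := by ring
  have hvol := h.sum_degree_bounds hN
  have h0 : 0 ≤ ∑ u, (G.degree u : ℝ) * f u ^ 2 := Finset.sum_nonneg fun u _ => by positivity
  have hN2 : (0 : ℝ) < (V₁.card : ℝ) ^ 2 := by positivity
  rw [e] at hle
  have := mul_le_mul_of_nonneg_right hvol h0
  have h5 : (V₁.card : ℝ) ^ 2 * ∑ u, (G.degree u : ℝ) * f u ^ 2 ≤
      (V₁.card : ℝ) ^ 2 * (2 * ∑ u, ∑ w, (f u - f w) ^ 2) := by linarith
  exact le_of_mul_le_mul_left h5 hN2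

theorem eigenvalue_le (h : IsJoinedCliques G V₁ V₂ k) (hN : 2 ≤ V₁.card)
    (hk : k ≤ V₁.card ^ 2) {lam : ℝ} {f : V → ℝ} (hf0 : f ≠ 0)
    (hf : (walkMatrix G).mulVec f = lam • f) (h1 : lam ≠ 1) :
    lam ≤ 1 - k / (28 * (V₁.card : ℝ) ^ 2) := by
  classical
  have hd := h.degree_pos hN
  have hN' : (2 : ℝ) ≤ V₁.card := by exact_mod_cast hN
  have hD := dirichletForm_of_eigenvector hd hf
  have hle := h.sum_degree_mul_sq_le hN (sum_degree_mul_eq_zero_of_eigenvector hd hf h1)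
  have hpos := sum_degree_mul_sq_pos hd hf0
  have hP := h.poincare hk f
  rw [hD] at hP
  have h2 := mul_le_mul_of_nonneg_left hle (Nat.cast_nonneg (α := ℝ) k)
  have h3 : (k : ℝ) * ∑ u, (G.degree u : ℝ) * f u ^ 2 ≤
      28 * (V₁.card : ℝ) ^ 2 * (1 - lam) * ∑ u, (G.degree u : ℝ) * f u ^ 2 := by linarith
  have h4 := le_of_mul_le_mul_right h3 hpos
  have h5 : k / (28 * (V₁.card : ℝ) ^ 2) ≤ 1 - lam := by
    rw [div_le_iff₀ (by positivity)]
    linarith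
  linarith

/-- Over all ordered pairs of the clique the squares add up to `2 * N * ∑ f ^ 2 + 2 * (∑ f) ^ 2`;
the missing diagonal takes away `4 * ∑ f ^ 2`. -/
theorem sum_sum_add_sq_ge (h : IsJoinedCliques G V₁ V₂ k) (f : V → ℝ) :
    2 * ((V₁.card : ℝ) - 2) * ∑ u ∈ V₁, f u ^ 2 ≤
      ∑ u ∈ V₁, ∑ w ∈ V₁, adjWeight G u w * (f u + f w) ^ 2 := by
  classical
  have e : ∑ u ∈ V₁, ∑ w ∈ V₁, adjWeight G u w * (f u + f w) ^ 2 =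
      ∑ u ∈ V₁, (∑ w ∈ V₁, (f u + f w) ^ 2 - 4 * f u ^ 2) := by
    apply Finset.sum_congr rfl
    intro u hu
    rw [← Finset.add_sum_erase V₁ _ hu, ← Finset.add_sum_erase V₁ (fun w => (f u + f w) ^ 2) hu]
    have h0 : adjWeight G u u = 0 := by simp [adjWeight]
    have h1 : ∑ w ∈ V₁.erase u, adjWeight G u w * (f u + f w) ^ 2 =
        ∑ w ∈ V₁.erase u, (f u + f w) ^ 2 := by
      apply Finset.sum_congr rfl
      intro w hw
      rw [h.adjWeight_eq_one hu (Finset.mem_of_mem_erase hw) (Finset.ne_of_mem_erase hw).symm,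
        one_mul]
    rw [h0, h1]
    ring
  have e2 : ∑ u ∈ V₁, ∑ w ∈ V₁, (f u + f w) ^ 2 =
      2 * (V₁.card : ℝ) * ∑ u ∈ V₁, f u ^ 2 + 2 * (∑ u ∈ V₁, f u) ^ 2 := by
    have e3 : ∑ u ∈ V₁, ∑ w ∈ V₁, (f u + f w) ^ 2 =
        ∑ u ∈ V₁, ∑ w ∈ V₁, f u ^ 2 + ∑ u ∈ V₁, ∑ w ∈ V₁, f w ^ 2 +
          2 * ((∑ u ∈ V₁, f u) * (∑ w ∈ V₁, f w)) := by
      rw [Finset.sum_mul_sum]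
      simp only [Finset.mul_sum, ← Finset.sum_add_distrib]
      exact Finset.sum_congr rfl fun u _ => Finset.sum_congr rfl fun w _ => by ring
    rw [e3]
    simp only [Finset.sum_const, nsmul_eq_mul]
    rw [← Finset.mul_sum]
    ring
  rw [e, Finset.sum_sub_distrib, e2, ← Finset.mul_sum]
  nlinarith [sq_nonneg (∑ u ∈ V₁, f u)]

/-- The signless form on the cliques alone yields `1 + lam ≥ (N - 2) / (2 * N - 1)`, which is at
least `1 / 5` for `N ≥ 3`. For `N = 2` the graph can be a 4-cycle, with eigenvalue `-1`. -/
theorem neg_le_eigenvalue (h : IsJoinedCliques G V₁ V₂ k) (hN : 3 ≤ V₁.card)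
    {lam : ℝ} {f : V → ℝ} (hf0 : f ≠ 0) (hf : (walkMatrix G).mulVec f = lam • f) :
    -(4 / 5) ≤ lam := by
  classical
  have hd := h.degree_pos (by omega)
  have hN' : (3 : ℝ) ≤ V₁.card := by exact_mod_cast hN
  have hS := sum_adjWeight_mul_add_sq_of_eigenvector hd hf
  have hpos := sum_degree_mul_sq_pos hd hf0
  have h1 := h.sum_sum_add_sq_ge f
  have h2 := h.symm.sum_sum_add_sq_ge f
  rw [← h.card_eq] at h2
  have h3 : 2 * ((V₁.card : ℝ) - 2) * ∑ u, f u ^ 2 ≤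
      ∑ u, ∑ w, adjWeight G u w * (f u + f w) ^ 2 := by
    rw [h.sum_univ (fun u => f u ^ 2), h.sum_univ (fun u => ∑ w, adjWeight G u w * (f u + f w) ^ 2)]
    have hmono : ∀ W U : Finset V, ∑ u ∈ W, ∑ w ∈ U, adjWeight G u w * (f u + f w) ^ 2 ≤
        ∑ u ∈ W, ∑ w, adjWeight G u w * (f u + f w) ^ 2 := fun W U =>
      Finset.sum_le_sum fun u _ => Finset.sum_le_sum_of_subset_of_nonneg (Finset.subset_univ _)
        fun w _ _ => mul_nonneg (adjWeight_nonneg u w) (sq_nonneg _)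
    have := hmono V₁ V₁
    have := hmono V₂ V₂
    linarith
  have h4 : ∑ u, (G.degree u : ℝ) * f u ^ 2 ≤ (2 * V₁.card - 1) * ∑ u, f u ^ 2 := by
    rw [Finset.mul_sum]
    apply Finset.sum_le_sum
    intro u _
    apply mul_le_mul_of_nonneg_right _ (sq_nonneg _)
    have hu : (G.degree u : ℝ) + 1 ≤ 2 * V₁.card := by exact_mod_cast h.degree_lt_two_mul_card u
    linarith
  rw [hS] at h3
  set Q := ∑ u, (G.degree u : ℝ) * f u ^ 2
  set R := ∑ u, f u ^ 2
  have hR : 0 ≤ R := Finset.sum_nonneg fun u _ => sq_nonneg _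
  have h5 : (1 / 5 : ℝ) * Q ≤ (1 + lam) * Q := by
    have : (2 * (V₁.card : ℝ) - 1) * R ≤ 5 * ((V₁.card - 2) * R) := by nlinarith
    linarith
  have := le_of_mul_le_mul_right h5 hpos
  linarith

theorem le_walkGap_of_three_le (h : IsJoinedCliques G V₁ V₂ k) (hN : 3 ≤ V₁.card)
    (hk : k ≤ V₁.card ^ 2) : k / (28 * (V₁.card : ℝ) ^ 2) ≤ walkGap G := by
  have hN' : (3 : ℝ) ≤ V₁.card := by exact_mod_cast hN
  have hk' : (k : ℝ) ≤ (V₁.card : ℝ) ^ 2 := by exact_mod_cast hk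
  have hle : k / (28 * (V₁.card : ℝ) ^ 2) ≤ 1 / 28 := by
    rw [div_le_iff₀ (by positivity)]
    linarith
  apply le_walkGap (by linarith)
  intro lam hlam h1
  classical
  obtain ⟨f, hf0, hf⟩ := hlam.exists_mulVec_eq
  rw [abs_le]
  constructor
  · linarith [h.neg_le_eigenvalue hN hf0 hf]
  · exact h.eigenvalue_le (by omega) hk hf0 hf (by linarith [(abs_lt.1 h1).2])

/-- The test function `±1` has Dirichlet form `8 * k` and mass at least `N ^ 2`, so its Rayleigh
quotient is at least `1 - 4 * k / N ^ 2`. It is orthogonal to constants, which rules out the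
eigenvalue `1`. -/
theorem walkGap_le (h : IsJoinedCliques G V₁ V₂ k) (hN : 2 ≤ V₁.card) (hk1 : 1 ≤ k)
    (hk : k ≤ V₁.card ^ 2) : walkGap G ≤ 4 * k / (V₁.card : ℝ) ^ 2 := by
  classical
  have hd := h.degree_pos hN
  have hN' : (2 : ℝ) ≤ V₁.card := by exact_mod_cast hN
  -- In the second case the eigenvalue found below is positive and equals its absolute value.
  rcases le_or_gt (1 - 4 * k / (V₁.card : ℝ) ^ 2) 0 with hr | hr
  · linarith [walkGap_le_one G]
  let f : V → ℝ := fun v => if v ∈ V₁ then 1 else -1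
  have hf1 : ∀ v ∈ V₁, f v = 1 := fun v hv => by simp [f, hv]
  have hf2 : ∀ v ∈ V₂, f v = -1 := fun v hv => by
    simp [f, Finset.disjoint_right.1 h.disjoint hv]
  have hsq : ∀ v, f v ^ 2 = 1 := fun v => by
    rcases h.cover v with hv | hv
    · simp [hf1 v hv]
    · simp [hf2 v hv]
  have hf0 : f ≠ 0 := by
    obtain ⟨v, hv⟩ : V₁.Nonempty := Finset.card_pos.1 (by omega)
    intro h0
    have := hsq v
    rw [h0] at this
    simp at this
  have vol : ∀ {V₁ V₂ : Finset V}, IsJoinedCliques G V₁ V₂ k →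
      ∑ u ∈ V₁, (G.degree u : ℝ) = V₁.card * ((V₁.card : ℝ) - 1) + k := by
    intro V₁ V₂ h
    have : ∀ u ∈ V₁, (G.degree u : ℝ) = ((V₁.card : ℝ) - 1) + degreeInto G V₂ u := by
      intro u hu
      have : (G.degree u : ℝ) + 1 = V₁.card + degreeInto G V₂ u := by
        exact_mod_cast h.degree_add_one hu
      linarith
    rw [Finset.sum_congr rfl this, Finset.sum_add_distrib, Finset.sum_const, nsmul_eq_mul]
    congr 1
    exact_mod_cast h.cut
  have horth : ∑ u, (G.degree u : ℝ) * f u = 0 := by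
    rw [h.sum_univ, Finset.sum_congr rfl (fun u hu => by rw [hf1 u hu, mul_one]),
      Finset.sum_congr (s₁ := V₂) rfl (fun u hu => by rw [hf2 u hu, mul_neg_one]),
      Finset.sum_neg_distrib, vol h, vol h.symm, h.card_eq]
    ring
  have hD : dirichletForm G f = 8 * k := by
    rw [h.dirichletForm_eq_blocks]
    have e1 : ∑ u ∈ V₁, ∑ w ∈ V₁, (f u - f w) ^ 2 = 0 :=
      Finset.sum_eq_zero fun u hu => Finset.sum_eq_zero fun w hw => by
        rw [hf1 u hu, hf1 w hw]; ring
    have e2 : ∑ u ∈ V₂, ∑ w ∈ V₂, (f u - f w) ^ 2 = 0 :=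
      Finset.sum_eq_zero fun u hu => Finset.sum_eq_zero fun w hw => by
        rw [hf2 u hu, hf2 w hw]; ring
    have e3 : ∑ u ∈ V₁, ∑ w ∈ V₂, adjWeight G u w * (f u - f w) ^ 2 = 4 * k := by
      have : ∀ u ∈ V₁, ∑ w ∈ V₂, adjWeight G u w * (f u - f w) ^ 2 =
          4 * (degreeInto G V₂ u : ℝ) := by
        intro u hu
        rw [← sum_adjWeight_eq_degreeInto, Finset.mul_sum]
        apply Finset.sum_congr rfl
        intro w hw
        rw [hf1 u hu, hf2 w hw]
        ring
      rw [Finset.sum_congr rfl this, ← Finset.mul_sum]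
      congr 1
      exact_mod_cast h.cut
    rw [e1, e2, e3]
    ring
  have hQ : ∑ u, (G.degree u : ℝ) * f u ^ 2 = ∑ u, (G.degree u : ℝ) := by
    simp only [hsq, mul_one]
  have hform := dirichletForm_eq (G := G) f
  rw [hD, hQ] at hform
  obtain ⟨lam, g, hlam, hg0, hg, hfg⟩ := exists_eigenvector_of_rayleigh (f := f) hd hf0
    (r := 1 - 4 * k / (V₁.card : ℝ) ^ 2) (by
      rw [hQ]
      have hvol := h.sum_degree_bounds hN
      have : 4 * (k : ℝ) ≤ 4 * k / (V₁.card : ℝ) ^ 2 * ∑ u, (G.degree u : ℝ) := by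
        rw [div_mul_eq_mul_div, le_div_iff₀ (by positivity)]
        exact mul_le_mul_of_nonneg_left hvol (by positivity)
      linarith)
  have hDg := dirichletForm_of_eigenvector hd hg
  have hpos := sum_degree_mul_sq_pos hd hg0
  have hle1 : lam ≤ 1 := by
    have := dirichletForm_nonneg (G := G) g
    rw [hDg] at this
    by_contra hc
    nlinarith
  -- An eigenvector for `1` has zero Dirichlet form and is constant by the Poincaré inequality with
  -- `k ≥ 1`, contradicting `hfg`.
  have hne : lam ≠ 1 := by
    intro h1
    have hP := h.poincare hk g
    rw [hDg, h1] at hP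
    have hk0 : (0 : ℝ) < k := by exact_mod_cast hk1
    have hz : ∑ u, ∑ w, (g u - g w) ^ 2 = 0 := by
      apply le_antisymm
      · by_contra hc
        have := mul_pos hk0 (not_le.1 hc)
        linarith
      · exact Finset.sum_nonneg fun u _ => Finset.sum_nonneg fun w _ => sq_nonneg _
    have hconst : ∀ u w, g u = g w := by
      intro u w
      have h2 := (Finset.sum_eq_zero_iff_of_nonneg fun u _ =>
        Finset.sum_nonneg fun w _ => sq_nonneg (g u - g w)).1 hz u (Finset.mem_univ _)
      have h3 := (Finset.sum_eq_zero_iff_of_nonneg fun w _ => sq_nonneg (g u - g w)).1 h2 w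
        (Finset.mem_univ _)
      have := pow_eq_zero_iff (two_ne_zero) |>.1 h3
      linarith
    obtain ⟨v, _⟩ : V₁.Nonempty := Finset.card_pos.1 (by omega)
    apply hfg
    calc ∑ u, (G.degree u : ℝ) * (f u * g u) = (∑ u, (G.degree u : ℝ) * f u) * g v := by
          rw [Finset.sum_mul]
          exact Finset.sum_congr rfl fun u _ => by rw [hconst u v]; ring
      _ = 0 := by rw [horth, zero_mul]
  have hlt : lam < 1 := lt_of_le_of_ne hle1 hne
  have hlam0 : 0 < lam := by linarith
  have heig : Module.End.HasEigenvalue (walkMatrix G).mulVecLin lam :=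
    Module.End.hasEigenvalue_of_hasEigenvector
      (Module.End.hasEigenvector_iff.2 ⟨Module.End.mem_eigenspace_iff.2 (by simpa using hg), hg0⟩)
  have := walkGap_le_of_hasEigenvalue heig (by rwa [abs_of_pos hlam0])
  rw [abs_of_pos hlam0] at this
  linarith

end IsJoinedCliques

/-- The gap of two joined cliques on `n` vertices is of the order `k / n ^ 2`. -/
theorem exists_le_walkGap : ∃ δ : ℝ, 0 < δ ∧
    ∀ (n k : ℕ) (G : SimpleGraph (Fin n)) (V₁ V₂ : Finset (Fin n)),
      IsJoinedCliques G V₁ V₂ k → 1 ≤ k → 5 * k ≤ n ^ 2 →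
      δ * (k / (n : ℝ) ^ 2) ≤ walkGap G := by
  -- The case `n = 4`, where the graph may be bipartite, is covered by the least gap among the
  -- finitely many graphs on four vertices.
  obtain ⟨G₀, hG₀⟩ := Finite.exists_min (fun G : SimpleGraph (Fin 4) => walkGap G)
  refine ⟨min (1 / 7) (walkGap G₀), lt_min (by norm_num) (walkGap_pos G₀), ?_⟩
  intro n k G V₁ V₂ h hk hk'
  have hN : 2 ≤ V₁.card := h.two_le_card hk (by simpa using hk')
  have hn : n = 2 * V₁.card := by simpa using h.card
  have hkN : k ≤ V₁.card ^ 2 := by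
    rw [hn] at hk'
    nlinarith
  have hn' : (n : ℝ) = 2 * V₁.card := by exact_mod_cast hn
  rcases Nat.lt_or_ge 2 V₁.card with h3 | h3
  · calc _ ≤ 1 / 7 * (k / (n : ℝ) ^ 2) :=
          mul_le_mul_of_nonneg_right (min_le_left _ _) (by positivity)
      _ = k / (28 * (V₁.card : ℝ) ^ 2) := by
          rw [hn']
          field_simp
          ring
      _ ≤ _ := h.le_walkGap_of_three_le h3 hkN
  · have h4 : n = 4 := by omega
    subst h4
    have h5 : (k : ℝ) / ((4 : ℕ) : ℝ) ^ 2 ≤ 1 := by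
      have : (k : ℝ) ≤ 4 := by
        have : k ≤ 4 := by omega
        exact_mod_cast this
      norm_num
      linarith
    calc _ ≤ walkGap G₀ * 1 :=
          mul_le_mul (min_le_right _ _) h5 (by positivity) (walkGap_pos G₀).le
      _ ≤ _ := by
          rw [mul_one]
          exact hG₀ G

end SpectralGap

/-! ### Assembly of the theorem -/

theorem theorem3 :
    -- the class contains a graph for all admissible parameters
    (∀ N k : ℕ, 1 ≤ k → 5 * k ≤ (2 * N) ^ 2 →
      ∃ (G : SimpleGraph (Fin (2 * N))) (V₁ V₂ : Finset (Fin (2 * N))),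
        IsJoinedCliques G V₁ V₂ k) ∧
    -- the whole class: `MIX(G) = Θ(ln n * n ^ 2 / k)`, and a lower bound of the order
    -- `n ^ 2 / k * ln m`, which is `MIX(G) / ln n * ln m`
    (∃ c C : ℝ, 0 < c ∧ 0 < C ∧
      ∀ (n k : ℕ) (G : SimpleGraph (Fin n)) (V₁ V₂ : Finset (Fin n)),
        IsJoinedCliques G V₁ V₂ k → 1 ≤ k → 5 * k ≤ n ^ 2 →
        (0 < walkGap G ∧ c * (Real.log n * ((n : ℝ) ^ 2 / k)) ≤ mixingTime G ∧
          mixingTime G ≤ C * (Real.log n * ((n : ℝ) ^ 2 / k))) ∧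
        ∀ ε : ℝ, 0 < ε → ε ≤ 1 / 2 → ∀ m : ℕ, C * (n : ℝ) ≤ m →
          ∀ T : ℕ, T = ⌈(1 + ε) * (averageLoad m n : ℝ)⌉₊ →
            AboveAverage (fun (_ : Fin m) (_ : Fin n) => (T : ℝ)) ∧
            ∃ (v : Fin n) (a : Fin m → Fin n),
              v ∈ V₁ ∧ degreeInto G V₂ v = k / (n / 2) ∧
              (∀ u ∈ V₁, u ≠ v → load a u = T) ∧ T ≤ load a v ∧ (∀ u ∈ V₂, load a u = 0) ∧
              ENNReal.ofReal (c * (mixingTime G / Real.log n) * Real.log m) ≤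
                expectedRounds G (fun _ _ => (T : ℝ)) a ∧
              ENNReal.ofReal (c * ((n : ℝ) ^ 2 / k) * Real.log m) ≤
                expectedRounds G (fun _ _ => (T : ℝ)) a) ∧
    -- the subclass `k ≥ κ n ln n`: a lower bound of the order `MIX(G) * ln m`
    (∀ κ : ℝ, 0 < κ → ∃ c C : ℝ, 0 < c ∧ 0 < C ∧
      ∀ (n k : ℕ) (G : SimpleGraph (Fin n)) (V₁ V₂ : Finset (Fin n)),
        IsJoinedCliques G V₁ V₂ k → 1 ≤ k → 5 * k ≤ n ^ 2 → κ * n * Real.log n ≤ k →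
        ∀ m : ℕ, C * (n : ℝ) ^ 2 ≤ m →
          ∀ T : ℕ, T = averageLoad m n + 1 →
            AboveAverage (fun (_ : Fin m) (_ : Fin n) => (T : ℝ)) ∧
            ∃ a : Fin m → Fin n,
              ENNReal.ofReal (c * mixingTime G * Real.log m) ≤
                expectedRounds G (fun _ _ => (T : ℝ)) a) := by
  obtain ⟨δ, hδ, hgap⟩ := exists_le_walkGap
  have hparam : ∀ {n k : ℕ} {G : SimpleGraph (Fin n)} {V₁ V₂ : Finset (Fin n)},
      IsJoinedCliques G V₁ V₂ k → 1 ≤ k → 5 * k ≤ n ^ 2 →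
      (4 : ℝ) ≤ n ∧ (1 : ℝ) ≤ k ∧ 0 < Real.log n := by
    intro n k G V₁ V₂ h hk hk'
    have hN : 2 ≤ V₁.card := h.two_le_card hk (by simpa using hk')
    have hn : n = 2 * V₁.card := by simpa using h.card
    have hn4 : (4 : ℝ) ≤ n := by
      have : 4 ≤ n := by omega
      exact_mod_cast this
    exact ⟨hn4, by exact_mod_cast hk, Real.log_pos (by linarith)⟩
  have hmix : ∀ {n k : ℕ} {G : SimpleGraph (Fin n)} {V₁ V₂ : Finset (Fin n)},
      IsJoinedCliques G V₁ V₂ k → 1 ≤ k → 5 * k ≤ n ^ 2 →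
      mixingTime G ≤ 4 / δ * (Real.log n * ((n : ℝ) ^ 2 / k)) := by
    intro n k G V₁ V₂ h hk hk'
    obtain ⟨hn, hk0, hlog⟩ := hparam h hk hk'
    have hg := hgap n k G V₁ V₂ h hk hk'
    unfold mixingTime
    rw [Fintype.card_fin]
    calc 4 * Real.log n / walkGap G ≤ 4 * Real.log n / (δ * (k / (n : ℝ) ^ 2)) :=
          div_le_div_of_nonneg_left (by positivity) (by positivity) hg
      _ = _ := by field_simp
  refine ⟨fun N k hk hk' => exists_isJoinedCliques N k ?_ ?_, ?_, ?_⟩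
  · by_contra hN
    have : N = 0 := by omega
    subst this
    omega
  · nlinarith
  -- `1 / 4` comes from the gap bound `4 * k / N ^ 2 = 16 * k / n ^ 2`, `1 / 384` from the clique
  -- state, and `δ / 1536` is `1 / 384` divided by the factor `4 / δ` of the upper bound on the
  -- mixing time.
  · refine ⟨min (1 / 4) (min (1 / 384) (δ / 1536)), max (4 / δ) 144, by positivity,
      by positivity, ?_⟩
    set c : ℝ := min (1 / 4) (min (1 / 384) (δ / 1536))
    have hc0 : 0 < c := by positivity
    have hc1 : c ≤ 1 / 4 := min_le_left _ _
    have hc2 : c ≤ 1 / 384 := (min_le_right _ _).trans (min_le_left _ _)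
    have hc3 : c ≤ δ / 1536 := (min_le_right _ _).trans (min_le_right _ _)
    intro n k G V₁ V₂ h hk hk'
    obtain ⟨hn, hk0, hlog⟩ := hparam h hk hk'
    have hcard : n = 2 * V₁.card := by simpa using h.card
    have hcard' : (n : ℝ) = 2 * V₁.card := by exact_mod_cast hcard
    refine ⟨⟨walkGap_pos G, ?_, ?_⟩, ?_⟩
    · have hN : 2 ≤ V₁.card := h.two_le_card hk (by simpa using hk')
      have hle := h.walkGap_le hN hk (by rw [hcard] at hk'; nlinarith)
      have hpos := walkGap_pos G
      unfold mixingTime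
      rw [Fintype.card_fin]
      calc c * (Real.log n * ((n : ℝ) ^ 2 / k)) ≤ 1 / 4 * (Real.log n * ((n : ℝ) ^ 2 / k)) :=
            mul_le_mul_of_nonneg_right hc1 (by positivity)
        _ = 4 * Real.log n / (4 * k / (V₁.card : ℝ) ^ 2) := by
            rw [hcard']
            have : (V₁.card : ℝ) ≠ 0 := by
              intro h0
              rw [h0] at hcard'
              linarith
            field_simp
            ring
        _ ≤ _ := div_le_div_of_nonneg_left (by positivity) hpos hle
    · refine (hmix h hk hk').trans ?_
      exact mul_le_mul_of_nonneg_right (le_max_left _ _) (by positivity)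
    · intro ε hε hε' m hm T hT
      have hm144 : 144 * (n : ℝ) ≤ m := le_trans (by gcongr; exact le_max_right _ _) hm
      have hm1 : (1 : ℝ) ≤ m := by linarith
      refine ⟨fun i v => ?_, ?_⟩
      · rw [Fintype.card_fin]
        have havg : 0 < (averageLoad m n : ℝ) :=
          lt_of_lt_of_le (by positivity) (div_le_averageLoad m n)
        calc (averageLoad m n : ℝ) < (1 + ε) * averageLoad m n := by nlinarith
          _ ≤ (T : ℝ) := by
            rw [hT]
            exact Nat.le_ceil _
      · obtain ⟨v, a, hv, hdv, hfull, hlv, hempty, hE⟩ :=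
          h.exists_clique_state hk hk' hε' hm144 hT
        have hlogm : 0 ≤ Real.log m := Real.log_nonneg hm1
        refine ⟨v, a, hv, hdv, hfull, hlv, hempty, le_trans (ENNReal.ofReal_le_ofReal ?_) hE,
          le_trans (ENNReal.ofReal_le_ofReal ?_) hE⟩
        · apply mul_le_mul_of_nonneg_right _ hlogm
          have h1 : mixingTime G / Real.log n ≤ 4 / δ * ((n : ℝ) ^ 2 / k) := by
            rw [div_le_iff₀ hlog]
            linarith [hmix h hk hk']
          calc c * (mixingTime G / Real.log n) ≤ c * (4 / δ * ((n : ℝ) ^ 2 / k)) := by gcongr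
            _ ≤ δ / 1536 * (4 / δ * ((n : ℝ) ^ 2 / k)) :=
                mul_le_mul_of_nonneg_right hc3 (by positivity)
            _ = _ := by field_simp; norm_num
        · apply mul_le_mul_of_nonneg_right _ hlogm
          exact mul_le_mul_of_nonneg_right hc2 (by positivity)
  · intro κ hκ
    -- For `k ≥ κ n log n` the mixing time is at most `4 / δ * (n / κ)`; this `c` turns it into the
    -- `n / 96` of the hole state.
    refine ⟨κ * δ / 384, 4, by positivity, by norm_num, ?_⟩
    intro n k G V₁ V₂ h hk hk' hκk m hm T hT
    obtain ⟨hn, hk0, hlog⟩ := hparam h hk hk'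
    refine ⟨fun i v => ?_, ?_⟩
    · rw [Fintype.card_fin, hT]
      push_cast
      linarith
    · obtain ⟨a, hE⟩ := h.exists_hole_state hk hk' hm hT
      refine ⟨a, le_trans (ENNReal.ofReal_le_ofReal ?_) hE⟩
      have hlogm : 0 ≤ Real.log m := Real.log_nonneg (by nlinarith)
      have h1 : Real.log n * ((n : ℝ) ^ 2 / k) ≤ n / κ := by
        rw [← mul_div_assoc, div_le_div_iff₀ (by positivity) hκ]
        calc Real.log n * (n : ℝ) ^ 2 * κ = n * (κ * n * Real.log n) := by ring
          _ ≤ n * k := by gcongr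
      calc κ * δ / 384 * mixingTime G * Real.log m
          ≤ κ * δ / 384 * (4 / δ * (n / κ)) * Real.log m := by
            gcongr
            exact (hmix h hk hk').trans (by gcongr)
        _ = _ := by
            field_simp
            ring
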